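/- **Model.** A base station (eNB) is located at the origin of $\mathbb R^2$. The D2D transmitters form a homogeneous Poisson point process $\Phi=\{x_k\}$ of density $\lambda>0$ in the whole plane. Each transmitter carries a mark $Q_k\in\{1,\dots,M\}$ (it shares resources with cellular user $c_{Q_k}$); the marks are i.i.d., and $q=\mathbb P[Q_k=m]$ for the cellular user $c_m$ under consideration. The D2D transmit powers $p_k\ge 0$ are i.i.d. with $\mathbb E[p_k^{2/\alpha}]<\infty$. The cellular user $c_m$ is uniformly distributed in the disk of radius $R_{\mathrm C}>0$ centered at the eNB and transmits with a random power $p_0>0$; $d_{0,c_m}$ is its distance to the eNB. Fading is Rayleigh: $|h_{0,c_m}|^2$ and all $|h_{0,k}|^2$ are $\mathrm{Exp}(1)$ distributed. The point process, all marks, all powers, all channel gains and the positions of the cellular users are mutually independent. With path-loss exponent $\alpha>2$, noise variance $\sigma^2\ge 0$ and threshold $\beta_0>0$, let $$\mathrm{SINR}_0=\frac{p_0|h_{0,c_m}|^2d_{0,c_m}^{-\alpha}}{\sum_{k:\,Q_k=m}p_k|h_{0,k}|^2\|x_k\|^{-\alpha}+\sigma^2},\qquad \mathcal P_{\mathrm{cov,C}}(\beta_0)=\mathbb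 P(\mathrm{SINR}_0\ge\beta_0),$$ where the ratio is $+\infty$ if the numerator is positive and the denominator is $0$. Write $\mathrm{sinc}(x)=\sin(\pi x)/(\pi x)$. **Proposition 1.** The uplink cellular coverage probability is $$\mathcal P_{\mathrm{cov,C}}(\beta_0)=\mathbb E_X\big[e^{-\beta_0\sigma^2X-\theta_0X^{2/\alpha}}\big],\qquad \theta_0=\frac{\pi q\lambda\beta_0^{2/\alpha}}{\mathrm{sinc}(2/\alpha)}\,\mathbb E[p_k^{2/\alpha}],$$ where $X=d_{0,c_m}^{\alpha}p_0^{-1}$ is the random variable with cdf $F_X(x)=\int F_{d_{0,c_m}}(x^{1/\alpha}p^{1/\alpha})\,dF_{p_0}(p)$ for $x\ge 0$ and $F_X(x)=0$ for $x<0$. The number $K'$ of D2D transmitters with mark $m$ in the disk of radius $R_{\mathrm C}$ centered at the eNB satisfies $\mathbb E[K']=q\lambda\pi R_{\mathrm C}^2$. In the interference-limited case $\sigma^2=0$ with a constant power $p_0>0$, $$\mathcal P_{\mathrm{cov,C}}(\beta_0)=\int_0^{R_{\mathrm C}}\exp\!\big(-\theta_0r^2p_0^{-2/\alpha}\big)\frac{2r}{R_{\mathrm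 C}^2}\,dr,$$ and if moreover $q>0$ and $\mathbb E[p_k^{2/\alpha}]>0$, this equals $$\frac{1-e^{-c}}{c},\qquad c=\frac{\mathbb E[K']\,\beta_0^{2/\alpha}}{\mathrm{sinc}(2/\alpha)\,p_0^{2/\alpha}}\,\mathbb E[p_k^{2/\alpha}]>0 .$$ -/

import Mathlib

open MeasureTheory ProbabilityTheory

noncomputable section

namespace D2D

/-- Number of indices `k` with `x k ω ∈ B`: the number of points (with multiplicity) of the random
configuration `x 0 ω, x 1 ω, …` that fall into `B`. -/
def count {Ω S : Type*} (x : ℕ → Ω → S) (B : Set S) (ω : Ω) : ℕ∞ :=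
  {k : ℕ | x k ω ∈ B}.encard

/-- The points `x 0, x 1, …` form a Poisson point process with intensity measure `ν`:
the number of points in a set of finite intensity is Poisson with mean `ν B`, and the numbers of
points in finitely many disjoint sets are independent. (The points are enumerated by `ℕ`, which
loses nothing when `ν` has infinite total mass.) -/
structure IsPoissonProcess {Ω S : Type*} [MeasurableSpace Ω] [MeasurableSpace S]
    (μ : Measure Ω) (x : ℕ → Ω → S) (ν : Measure S) : Prop where
  measurable : ∀ k, Measurable (x k)
  poisson : ∀ B : Set S, MeasurableSet B → ν B < ⊤ → ∀ n : ℕ,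
    μ {ω | count x B ω = (n : ℕ∞)} = poissonMeasure (ν B).toNNReal {n}
  indep : ∀ (n : ℕ) (B : Fin n → Set S), (∀ i, MeasurableSet (B i)) → (∀ i, ν (B i) < ⊤) →
    Pairwise (fun i j => Disjoint (B i) (B j)) → iIndepFun (fun i ω => count x (B i) ω) μ

/-- The plane, with the base station (eNB) at the origin. -/
abbrev Plane := EuclideanSpace ℝ (Fin 2)

/-- The random quantities of the uplink of a cell with `M` cellular users that is underlaid with
device-to-device (D2D) links. -/
structure Network (Ω : Type*) (M : ℕ) where
  /-- positions of the D2D transmitters -/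
  pos : ℕ → Ω → Plane
  /-- mark of a D2D transmitter: the cellular user with which it shares resources -/
  mark : ℕ → Ω → Fin M
  /-- transmit powers of the D2D transmitters -/
  power : ℕ → Ω → ℝ
  /-- channel gains from the D2D transmitters to the eNB -/
  gain : ℕ → Ω → ℂ
  /-- positions of the cellular users -/
  cellPos : Fin M → Ω → Plane
  /-- transmit powers of the cellular users -/
  cellPower : Fin M → Ω → ℝ
  /-- channel gains from the cellular users to the eNB -/
  cellGain : Fin M → Ω → ℂ

/-- Labels of the independent sources of randomness of a network. -/
inductive Source (M : ℕ) where
  | pos : Source M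
  | mark (k : ℕ) : Source M
  | power (k : ℕ) : Source M
  | gain (k : ℕ) : Source M
  | cellPos (m : Fin M) : Source M
  | cellPower (m : Fin M) : Source M
  | cellGain (m : Fin M) : Source M

namespace Network

variable {Ω : Type*} {M : ℕ}

/-- The σ-algebra generated by a source of randomness; the whole point configuration is one
source. -/
@[reducible] def sigma (N : Network Ω M) : Source M → MeasurableSpace Ω
  | .pos => MeasurableSpace.comap (fun ω k => N.pos k ω) inferInstance
  | .mark k => MeasurableSpace.comap (N.mark k) ⊤
  | .power k => MeasurableSpace.comap (N.power k) inferInstance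
  | .gain k => MeasurableSpace.comap (N.gain k) inferInstance
  | .cellPos m => MeasurableSpace.comap (N.cellPos m) inferInstance
  | .cellPower m => MeasurableSpace.comap (N.cellPower m) inferInstance
  | .cellGain m => MeasurableSpace.comap (N.cellGain m) inferInstance

/-- The system model: the D2D transmitters form a homogeneous Poisson point process of density
`lam` in the whole plane, are marked independently with identically distributed marks, and use
i.i.d. nonnegative powers; the cellular users are uniform in the disk of radius `R` and have
positive powers; fading is Rayleigh (`|h|² ∼ Exp(1)`); everything is independent. -/
structure IsModel [MeasurableSpace Ω] (N : Network Ω M) (μ : Measure Ω) (lam R : ℝ) : Prop where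
  poisson : IsPoissonProcess μ N.pos (ENNReal.ofReal lam • volume)
  mark_measurable : ∀ k, Measurable (N.mark k)
  mark_ident : ∀ k, IdentDistrib (N.mark k) (N.mark 0) μ μ
  power_measurable : ∀ k, Measurable (N.power k)
  power_nonneg : ∀ k, ∀ᵐ ω ∂μ, 0 ≤ N.power k ω
  power_ident : ∀ k, IdentDistrib (N.power k) (N.power 0) μ μ
  gain_measurable : ∀ k, Measurable (N.gain k)
  gain_law : ∀ k, μ.map (fun ω => ‖N.gain k ω‖ ^ 2) = expMeasure 1
  cellPos_measurable : ∀ m, Measurable (N.cellPos m)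
  cellPos_uniform : ∀ m, pdf.IsUniform (N.cellPos m) (Metric.closedBall 0 R) μ volume
  cellPower_measurable : ∀ m, Measurable (N.cellPower m)
  cellPower_pos : ∀ m, ∀ᵐ ω ∂μ, 0 < N.cellPower m ω
  cellGain_measurable : ∀ m, Measurable (N.cellGain m)
  cellGain_law : ∀ m, μ.map (fun ω => ‖N.cellGain m ω‖ ^ 2) = expMeasure 1
  indep : iIndep N.sigma μ

/-- The distance `d_{0,c_m}` of cellular user `m` to the eNB. -/
def dist (N : Network Ω M) (m : Fin M) (ω : Ω) : ℝ := ‖N.cellPos m ω‖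

/-- The power received at the eNB from the D2D transmitters that share resources with cellular
user `m`. -/
def interference (N : Network Ω M) (α : ℝ) (m : Fin M) (ω : Ω) : ENNReal :=
  ∑' k, if N.mark k ω = m then
    ENNReal.ofReal (N.power k ω * ‖N.gain k ω‖ ^ 2 * ‖N.pos k ω‖ ^ (-α)) else 0

/-- The uplink signal-to-interference-plus-noise ratio of cellular user `m`. It is extended-real
valued, hence infinite for a positive signal without interference and noise. -/
def sinr (N : Network Ω M) (α σ : ℝ) (m : Fin M) (ω : Ω) : ENNReal :=
  ENNReal.ofReal (N.cellPower m ω * ‖N.cellGain m ω‖ ^ 2 * N.dist m ω ^ (-α)) /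
    (N.interference α m ω + ENNReal.ofReal (σ ^ 2))

/-- The coverage probability of cellular user `m` for the threshold `β`. -/
def coverage [MeasurableSpace Ω] (N : Network Ω M) (μ : Measure Ω) (α σ β : ℝ) (m : Fin M) : ℝ :=
  μ.real {ω | ENNReal.ofReal β ≤ N.sinr α σ m ω}

/-- The probability `q` that a D2D transmitter shares resources with cellular user `m`. -/
def markProb [MeasurableSpace Ω] (N : Network Ω M) (μ : Measure Ω) (m : Fin M) : ℝ :=
  μ.real {ω | N.mark 0 ω = m}

/-- The moment `𝔼[p_k^{2/α}]` of the D2D transmit powers. -/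
def powerMoment [MeasurableSpace Ω] (N : Network Ω M) (μ : Measure Ω) (α : ℝ) : ℝ :=
  ∫ ω, N.power 0 ω ^ (2 / α) ∂μ

/-- The random variable `X = d_{0,c_m}^α / p₀`. -/
def X (N : Network Ω M) (α : ℝ) (m : Fin M) (ω : Ω) : ℝ := N.dist m ω ^ α / N.cellPower m ω

/-- The number `K'` of D2D transmitters in the cell of radius `R` that share resources with
cellular user `m`. -/
def cellCount (N : Network Ω M) (R : ℝ) (m : Fin M) (ω : Ω) : ℕ∞ :=
  {k : ℕ | N.mark k ω = m ∧ N.pos k ω ∈ Metric.closedBall (0 : Plane) R}.encard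

end Network

/-- The normalized sinc function `sin(πx)/(πx)`. -/
def nsinc (x : ℝ) : ℝ := Real.sinc (Real.pi * x)

/-- The constant `θ₀` for thinning probability `q`, density `lam` and power moment `e`. -/
def theta (α lam β q e : ℝ) : ℝ :=
  Real.pi * q * lam * β ^ (2 / α) / nsinc (2 / α) * e

end D2D

end

/-! Clearing denominators, coverage is the event `β X (I + σ²) ≤ |h|²`, where `I` is the
interference and `|h|²` is an `Exp(1)` variable independent of `X` and `I`. The exponential tail
turns its probability into `E[exp (-β X (I + σ²))]`, so everything rests on the Laplace transform of
`I` at `s = β X`, with `X` independent of `I`.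

For a Poisson process, `E[exp (-∑ f(x_k))] = exp (-∫ (1 - exp (-f)) dν)`: this holds for step
functions by the Poisson generating function and independence over disjoint sets, and in general by
limits (`IsPoissonProcess.laplace`). I.i.d. labels are averaged out one at a time, which replaces
`exp (-f)` by its mean over the label (`IsPoissonProcess.laplace_marked`). Transmitters with the
wrong mark contribute zero, so thinning needs no separate argument.

The planar integral of `1 - exp (-c ‖x‖^(-α))` is `π c^(2/α) Γ(1 - 2/α)`. The fading moment
contributes `Γ(1 + 2/α)`, and the reflection formula merges the two into `1 / sinc(2/α)`, which
gives `θ₀`. The closed form follows by integrating over the law `2r/R² dr` of the distance.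

Working in `[0, ∞]` with `exp (-∞) = 0` avoids having to prove that the interference is finite. -/

noncomputable section

namespace D2D

/-! ### The exponential and logarithm on `[0, ∞]` -/

/-- The function `v ↦ exp (-v)` on `[0, ∞]`. -/
def expNeg (v : ENNReal) : ENNReal := (EReal.exp (v : EReal))⁻¹

@[simp] lemma expNeg_zero : expNeg 0 = 1 := by simp [expNeg]

@[simp] lemma expNeg_top : expNeg ⊤ = 0 := by simp [expNeg]

lemma expNeg_add (a b : ENNReal) : expNeg (a + b) = expNeg a * expNeg b := by
  have h (v : ENNReal) : EReal.exp (v : EReal) ≠ 0 := by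
    simp [EReal.exp_eq_zero_iff]
  rw [expNeg, EReal.coe_ennreal_add, EReal.exp_add,
    ENNReal.mul_inv (Or.inl (h a)) (Or.inr (h b)), expNeg, expNeg]

lemma expNeg_ofReal {r : ℝ} (hr : 0 ≤ r) :
    expNeg (ENNReal.ofReal r) = ENNReal.ofReal (Real.exp (-r)) := by
  rw [expNeg, EReal.coe_ennreal_ofReal, max_eq_left hr, EReal.exp_coe,
    ← ENNReal.ofReal_inv_of_pos (Real.exp_pos _), Real.exp_neg]

lemma expNeg_antitone : Antitone expNeg := fun _ _ h =>
  ENNReal.inv_le_inv.2 (EReal.exp_monotone (EReal.coe_ennreal_le_coe_ennreal_iff.2 h))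

lemma expNeg_le_one (a : ENNReal) : expNeg a ≤ 1 := by
  simpa using expNeg_antitone (zero_le (a := a))

lemma continuous_expNeg : Continuous expNeg :=
  continuous_inv.comp (ENNReal.continuous_exp.comp continuous_coe_ennreal_ereal)

@[fun_prop] lemma measurable_expNeg : Measurable expNeg := continuous_expNeg.measurable

lemma expNeg_sum {ι : Type*} (s : Finset ι) (f : ι → ENNReal) :
    expNeg (∑ i ∈ s, f i) = ∏ i ∈ s, expNeg (f i) := by
  induction s using Finset.cons_induction with
  | empty => simp
  | cons a s ha ih => rw [Finset.sum_cons, Finset.prod_cons, expNeg_add, ih]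

lemma expNeg_nsmul (n : ℕ) (a : ENNReal) : expNeg (n * a) = expNeg a ^ n := by
  induction n with
  | zero => simp
  | succ n ih => rw [Nat.cast_succ, add_mul, one_mul, expNeg_add, ih, pow_succ]

lemma tendsto_prod_expNeg (f : ℕ → ENNReal) :
    Filter.Tendsto (fun n => ∏ k ∈ Finset.range n, expNeg (f k)) Filter.atTop
      (nhds (expNeg (∑' k, f k))) := by
  simp_rw [← expNeg_sum]
  exact (continuous_expNeg.tendsto _).comp ENNReal.summable.hasSum.tendsto_sum_nat

/-- The function `u ↦ -log u` on `[0, 1]`. -/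
def negLog (u : ENNReal) : ENNReal := (-(ENNReal.log u)).toENNReal

@[fun_prop] lemma measurable_negLog : Measurable negLog := by
  unfold negLog
  fun_prop

/-- Allows a product of factors in `[0, 1]` to be read as `expNeg` of a sum. The bound on `u`
matters because `toENNReal` truncates negative values to zero. -/
lemma expNeg_negLog {u : ENNReal} (hu : u ≤ 1) : expNeg (negLog u) = u := by
  have h : 0 ≤ -(ENNReal.log u) := by
    rw [EReal.neg_nonneg, ← ENNReal.log_one]
    exact ENNReal.log_monotone hu
  rw [expNeg, negLog, EReal.coe_toENNReal h, EReal.exp_neg, inv_inv, ENNReal.exp_log]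

/-! ### The exponential law and the planar integral -/

instance isProbabilityMeasure_expMeasure_one : IsProbabilityMeasure (expMeasure 1) :=
  isProbabilityMeasure_expMeasure one_pos

lemma expMeasure_one_Iic {u : ℝ} (hu : 0 ≤ u) :
    expMeasure 1 (Set.Iic u) = ENNReal.ofReal (1 - Real.exp (-u)) := by
  rw [← ofReal_cdf, cdf_expMeasure_eq one_pos, if_pos hu, one_mul]

lemma expMeasure_one_eq : expMeasure 1
    = (volume.restrict (Set.Ioi 0)).withDensity (fun t => ENNReal.ofReal (Real.exp (-t))) := by
  rw [← withDensity_indicator measurableSet_Ioi, expMeasure, gammaMeasure]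
  refine withDensity_congr_ae ?_
  -- At `t = 0` the gamma density equals `1` while the indicator of `Ioi 0` vanishes.
  have h0 : ∀ᵐ t : ℝ, t ≠ 0 := by simp [ae_iff]
  filter_upwards [h0] with t ht
  rcases lt_or_gt_of_ne ht with h | h
  · rw [gammaPDF_of_neg h, Set.indicator_of_notMem (by simpa using h.le)]
  · rw [gammaPDF_of_nonneg h.le, Set.indicator_of_mem (by simpa using h)]
    simp

instance : NullSingletonClass (expMeasure 1) := by
  rw [expMeasure_one_eq]
  infer_instance

/-- The threshold is allowed to be infinite because it will contain the interference. -/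
lemma expMeasure_one_setOf_le (v : ENNReal) :
    expMeasure 1 {t | v ≤ ENNReal.ofReal t} = expNeg v := by
  induction v with
  | top => simp
  | coe v =>
    -- For `v = 0` the set is all of `ℝ`, not `Ici 0`, since `ENNReal.ofReal` sends negative numbers
    -- to zero.
    rcases eq_or_ne v 0 with rfl | hv
    · simp
    have h : {t : ℝ | (v : ENNReal) ≤ ENNReal.ofReal t} = Set.Ici (v : ℝ) := by
      ext t
      rw [Set.mem_ofPred_eq, ← ENNReal.ofReal_coe_nnreal, Set.mem_Ici,
        ENNReal.ofReal_le_ofReal_iff']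
      have : (0 : ℝ) < v := by positivity
      constructor
      · rintro (h | h)
        · exact h
        · exact absurd h this.not_ge
      · exact Or.inl
    rw [h, ← compl_compl (Set.Ici (v : ℝ)), prob_compl_eq_one_sub (by measurability), Set.compl_Ici,
      measure_congr Iio_ae_eq_Iic, expMeasure_one_Iic v.coe_nonneg, ← ENNReal.ofReal_coe_nnreal,
      expNeg_ofReal v.coe_nonneg, ENNReal.ofReal_sub _ (Real.exp_pos _).le, ENNReal.ofReal_one]
    refine ENNReal.sub_sub_cancel ENNReal.one_ne_top ?_
    simp

lemma lintegral_rpow_expMeasure_one {a : ℝ} (ha : -1 < a) :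
    ∫⁻ t, ENNReal.ofReal (t ^ a) ∂(expMeasure 1) = ENNReal.ofReal (Real.Gamma (1 + a)) := by
  rw [expMeasure_one_eq, lintegral_withDensity_eq_lintegral_mul _ (by fun_prop) (by fun_prop),
    Real.Gamma_eq_integral (by linarith),
    ofReal_integral_eq_lintegral_ofReal (Real.GammaIntegral_convergent (by linarith))]
  · refine setLIntegral_congr_fun measurableSet_Ioi fun t ht => ?_
    simp only [Pi.mul_apply]
    rw [← ENNReal.ofReal_mul (Real.exp_pos _).le, add_sub_cancel_left]
  · filter_upwards [ae_restrict_mem measurableSet_Ioi] with t ht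
    have : (0 : ℝ) < t := ht
    positivity

/-- Write `1 - exp (-u)` as `P(T ≤ u)` with `T` exponential and exchange the integrals. For fixed
`t`, the points with `t ≤ c ‖x‖^(-α)` fill a disk of area `π (c/t)^(2/α)`, and `E[T^(-2/α)] = Γ(1 -
2/α)` is finite because `α > 2`. -/
lemma lintegral_one_sub_expNeg_norm {α : ℝ} (hα : 2 < α) {c : ℝ} (hc : 0 ≤ c) :
    ∫⁻ x : Plane, (1 - expNeg (ENNReal.ofReal (c * ‖x‖ ^ (-α))))
      = ENNReal.ofReal (Real.pi * c ^ (2 / α) * Real.Gamma (1 - 2 / α)) := by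
  have hα0 : 0 < α := by linarith
  rcases hc.eq_or_lt with rfl | hc
  · simp [Real.zero_rpow (by positivity : (2 / α) ≠ 0)]
  have h1 (x : Plane) : 1 - expNeg (ENNReal.ofReal (c * ‖x‖ ^ (-α)))
      = ∫⁻ t, (if t ≤ c * ‖x‖ ^ (-α) then 1 else 0) ∂(expMeasure 1) := by
    have hu : 0 ≤ c * ‖x‖ ^ (-α) := by positivity
    rw [expNeg_ofReal hu, ← ENNReal.ofReal_one, ← ENNReal.ofReal_sub _ (Real.exp_pos _).le,
      ← expMeasure_one_Iic hu, ← lintegral_indicator_one measurableSet_Iic]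
    simp [Set.indicator_apply]
  have hm : Measurable fun z : Plane × ℝ => if z.2 ≤ c * ‖z.1‖ ^ (-α) then (1 : ENNReal) else 0 :=
    Measurable.ite (measurableSet_le (by fun_prop) (by fun_prop)) measurable_const measurable_const
  simp_rw [h1]
  rw [lintegral_lintegral_swap hm.aemeasurable]
  have hpos : ∀ᵐ t ∂(expMeasure 1), 0 < t := by
    rw [expMeasure_one_eq]
    exact (withDensity_absolutelyContinuous _ _).ae_le (ae_restrict_mem measurableSet_Ioi)
  have h2 : ∀ᵐ t ∂(expMeasure 1), ∫⁻ x : Plane, (if t ≤ c * ‖x‖ ^ (-α) then 1 else 0)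
      = ENNReal.ofReal (Real.pi * c ^ (2 / α)) * ENNReal.ofReal (t ^ (-(2 / α))) := by
    filter_upwards [hpos] with t ht
    -- The origin lies in the disk but violates the inequality, since `0 ^ (-α) = 0` by convention.
    have hx : ∀ᵐ x : Plane, x ≠ 0 := by simp [ae_iff]
    have h3 : ∫⁻ x : Plane, (if t ≤ c * ‖x‖ ^ (-α) then (1 : ENNReal) else 0)
        = ∫⁻ x : Plane, (Metric.closedBall (0 : Plane) ((c / t) ^ (1 / α))).indicator 1 x := by
      refine lintegral_congr_ae ?_
      filter_upwards [hx] with x hx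
      have hn : 0 < ‖x‖ := norm_pos_iff.2 hx
      have : t ≤ c * ‖x‖ ^ (-α) ↔ ‖x‖ ≤ (c / t) ^ (1 / α) := by
        rw [Real.rpow_neg hn.le, ← div_eq_mul_inv, le_div_iff₀ (by positivity), one_div,
          Real.le_rpow_inv_iff_of_pos hn.le (by positivity) hα0, le_div_iff₀ ht, mul_comm]
      by_cases h : ‖x‖ ≤ (c / t) ^ (1 / α)
      · rw [if_pos (this.2 h), Set.indicator_of_mem (mem_closedBall_zero_iff.2 h), Pi.one_apply]
      · rw [if_neg (mt this.1 h), Set.indicator_of_notMem (mt mem_closedBall_zero_iff.1 h)]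
    rw [h3, lintegral_indicator_one measurableSet_closedBall,
      EuclideanSpace.volume_closedBall_fin_two, ← ENNReal.ofReal_pow (by positivity),
      ← ENNReal.ofReal_mul (by positivity), ← ENNReal.ofReal_mul (by positivity)]
    congr 1
    rw [← Real.rpow_natCast, ← Real.rpow_mul (by positivity), Real.rpow_neg ht.le,
      Real.div_rpow hc.le ht.le]
    have : 1 / α * ((2 : ℕ) : ℝ) = 2 / α := by push_cast; ring
    rw [this]
    ring
  rw [lintegral_congr_ae h2, lintegral_const_mul _ (by fun_prop), lintegral_rpow_expMeasure_one,
    ← ENNReal.ofReal_mul (by positivity), ← sub_eq_add_neg]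
  rw [neg_lt_neg_iff, div_lt_one hα0]
  exact hα

/-! ### The Poisson law and the Laplace functional of a Poisson process -/

lemma lintegral_poissonMeasure (r : NNReal) (g : ℕ → ENNReal) :
    ∫⁻ n, g n ∂(poissonMeasure r)
      = ∑' n : ℕ, ENNReal.ofReal (Real.exp (-r) * r ^ n / n.factorial) * g n := by
  rw [lintegral_countable']
  simp_rw [poissonMeasure_singleton, mul_comm]

lemma lintegral_cast_poissonMeasure (r : NNReal) :
    ∫⁻ n, (n : ENNReal) ∂(poissonMeasure r) = r := by
  rw [lintegral_poissonMeasure, tsum_eq_zero_add' ENNReal.summable, Nat.cast_zero, mul_zero,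
    zero_add]
  have h (n : ℕ) : ENNReal.ofReal (Real.exp (-r) * r ^ (n + 1) / (n + 1).factorial)
      * ((n + 1 : ℕ) : ENNReal)
      = r * ENNReal.ofReal (Real.exp (-r) * r ^ n / n.factorial) := by
    rw [← ENNReal.ofReal_natCast, ← ENNReal.ofReal_coe_nnreal (p := r),
      ← ENNReal.ofReal_mul (by positivity), ← ENNReal.ofReal_mul (by positivity)]
    congr 1
    rw [Nat.factorial_succ]
    push_cast
    field_simp
    ring
  simp_rw [h]
  rw [ENNReal.tsum_mul_left, ← ENNReal.ofReal_tsum_of_nonneg (fun n => by positivity)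
    (hasSum_one_poissonMeasure r).summable, (hasSum_one_poissonMeasure r).tsum_eq]
  simp

/-- This is the generating function of the Poisson law at `u = expNeg a`, from the exponential
series at `r * u`. For `a = ⊤` it reduces to the probability of no point. -/
lemma lintegral_expNeg_poissonMeasure (r : NNReal) (a : ENNReal) :
    ∫⁻ n, expNeg (n * a) ∂(poissonMeasure r) = expNeg (r * (1 - expNeg a)) := by
  obtain ⟨u, hu0, hu1, hu⟩ : ∃ u : ℝ, 0 ≤ u ∧ u ≤ 1 ∧ expNeg a = ENNReal.ofReal u := by
    have h1 := expNeg_le_one a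
    refine ⟨(expNeg a).toReal, by positivity, ?_, ?_⟩
    · simpa using ENNReal.toReal_mono ENNReal.one_ne_top h1
    · rw [ENNReal.ofReal_toReal (h1.trans_lt ENNReal.one_lt_top).ne]
  rw [lintegral_poissonMeasure]
  have h (n : ℕ) : ENNReal.ofReal (Real.exp (-r) * r ^ n / n.factorial) * expNeg (n * a)
      = ENNReal.ofReal (Real.exp (-r) * ((r * u) ^ n / n.factorial)) := by
    rw [expNeg_nsmul, hu, ← ENNReal.ofReal_pow hu0, ← ENNReal.ofReal_mul (by positivity)]
    congr 1
    rw [mul_pow]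
    ring
  have hs := (NormedSpace.expSeries_div_hasSum_exp (r * u : ℝ)).mul_left (Real.exp (-r))
  simp_rw [h]
  rw [← ENNReal.ofReal_tsum_of_nonneg (fun n => by positivity) hs.summable, hs.tsum_eq, hu,
    ← ENNReal.ofReal_one, ← ENNReal.ofReal_sub _ hu0, ← ENNReal.ofReal_coe_nnreal (p := r),
    ← ENNReal.ofReal_mul (by positivity), expNeg_ofReal (by
      have := sub_nonneg.2 hu1
      positivity), ← Real.exp_eq_exp_ℝ, ← Real.exp_add]
  congr 2
  ring

lemma coe_count {Ω S : Type*} (x : ℕ → Ω → S) (B : Set S) (ω : Ω) :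
    (count x B ω : ENNReal) = ∑' k, B.indicator 1 (x k ω) := by
  rw [count, ← ENNReal.tsum_set_one, tsum_subtype {k : ℕ | x k ω ∈ B} (fun _ => (1 : ENNReal))]
  rfl

section Poisson

variable {Ω S : Type*} [MeasurableSpace Ω] [MeasurableSpace S] {μ : Measure Ω}
  {x : ℕ → Ω → S} {ν : Measure S}

lemma IsPoissonProcess.measurable_coe_count (h : IsPoissonProcess μ x ν) {B : Set S}
    (hB : MeasurableSet B) : Measurable fun ω => (count x B ω : ENNReal) := by
  simp_rw [coe_count]
  exact Measurable.tsum fun k => (measurable_one.indicator hB).comp (h.measurable k)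

lemma IsPoissonProcess.measurable_count (h : IsPoissonProcess μ x ν) {B : Set S}
    (hB : MeasurableSet B) : Measurable (count x B) := by
  refine measurable_to_countable' fun n => ?_
  have : count x B ⁻¹' {n} = (fun ω => (count x B ω : ENNReal)) ⁻¹' {(n : ENNReal)} := by
    ext ω
    simp
  rw [this]
  exact h.measurable_coe_count hB (measurableSet_singleton _)

lemma IsPoissonProcess.map_count [IsProbabilityMeasure μ] (h : IsPoissonProcess μ x ν)
    {B : Set S} (hB : MeasurableSet B) (hν : ν B < ⊤) :
    μ.map (count x B)
      = (poissonMeasure (ν B).toNNReal).map (Nat.cast : ℕ → ℕ∞) := by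
  have hm := h.measurable_count hB
  have := Measure.isProbabilityMeasure_map (μ := μ) hm.aemeasurable
  have key (n : ℕ) : μ.map (count x B) {(n : ℕ∞)}
      = (poissonMeasure (ν B).toNNReal).map (Nat.cast : ℕ → ℕ∞) {(n : ℕ∞)} := by
    rw [Measure.map_apply hm (measurableSet_singleton _),
      Measure.map_apply .of_discrete (measurableSet_singleton _)]
    have : (Nat.cast : ℕ → ℕ∞) ⁻¹' {(n : ℕ∞)} = {n} := by ext; simp
    rw [this, ← h.poisson B hB hν n]
    rfl
  refine Measure.ext_of_singleton fun n => ?_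
  induction n with
  | coe n => exact key n
  | top =>
    -- The defining property only concerns finite counts; the mass at `⊤` is what they leave of the
    -- total mass one.
    have ht : ({⊤} : Set ℕ∞) = (⋃ n : ℕ, {(n : ℕ∞)})ᶜ := by
      ext n
      induction n <;> simp
    have hd : Pairwise (Function.onFun Disjoint fun n : ℕ => ({(n : ℕ∞)} : Set ℕ∞)) := by
      intro i j hij
      simpa [Function.onFun] using hij
    rw [ht, prob_compl_eq_one_sub .of_discrete, prob_compl_eq_one_sub .of_discrete,
      measure_iUnion hd fun _ => .of_discrete, measure_iUnion hd fun _ => .of_discrete]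
    simp_rw [key]

lemma IsPoissonProcess.lintegral_count [IsProbabilityMeasure μ] (h : IsPoissonProcess μ x ν)
    {B : Set S} (hB : MeasurableSet B) (hν : ν B < ⊤) (g : ℕ∞ → ENNReal) :
    ∫⁻ ω, g (count x B ω) ∂μ = ∫⁻ n, g n ∂(poissonMeasure (ν B).toNNReal) := by
  rw [← lintegral_map (μ := μ) (f := g) .of_discrete (h.measurable_count hB),
    h.map_count hB hν, lintegral_map .of_discrete .of_discrete]

lemma IsPoissonProcess.lintegral_coe_count [IsProbabilityMeasure μ] (h : IsPoissonProcess μ x ν)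
    {B : Set S} (hB : MeasurableSet B) (hν : ν B < ⊤) :
    ∫⁻ ω, (count x B ω : ENNReal) ∂μ = ν B := by
  rw [h.lintegral_count hB hν (fun n => (n : ENNReal))]
  simp_rw [ENat.toENNReal_coe]
  rw [lintegral_cast_poissonMeasure, ENNReal.coe_toNNReal hν.ne]

lemma IsPoissonProcess.lintegral_expNeg_sum [IsProbabilityMeasure μ]
    (h : IsPoissonProcess μ x ν) {ι : Type*} [Fintype ι] (B : ι → Set S)
    (hB : ∀ i, MeasurableSet (B i)) (hν : ∀ i, ν (B i) < ⊤)
    (hd : Pairwise fun i j => Disjoint (B i) (B j)) (a : ι → ENNReal) :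
    ∫⁻ ω, expNeg (∑ i, count x (B i) ω * a i) ∂μ
      = expNeg (∑ i, ν (B i) * (1 - expNeg (a i))) := by
  -- Independence is assumed for families indexed by `Fin n`, hence the relabelling.
  let e := Fintype.equivFin ι
  have hi : iIndepFun (fun i ω => count x (B i) ω) μ := by
    have := h.indep _ (B ∘ e.symm) (fun i => hB _) (fun i => hν _)
      (fun i j hij => hd (e.symm.injective.ne hij))
    have := this.precomp e.injective
    simpa using this
  have hi' := hi.comp (fun i (n : ℕ∞) => expNeg (n * a i)) fun i => .of_discrete
  simp_rw [expNeg_sum]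
  rw [lintegral_prod_eq_prod_lintegral_of_indepFun Finset.univ
    (fun i ω => expNeg (count x (B i) ω * a i)) hi'
    fun i => measurable_expNeg.comp ((h.measurable_coe_count (hB i)).mul_const _)]
  refine Finset.prod_congr rfl fun i _ => ?_
  rw [h.lintegral_count (hB i) (hν i) (fun n => expNeg (n * a i))]
  simp_rw [ENat.toENNReal_coe]
  rw [lintegral_expNeg_poissonMeasure, ENNReal.coe_toNNReal (hν i).ne]

lemma IsPoissonProcess.laplace_simpleFunc [IsProbabilityMeasure μ]
    (h : IsPoissonProcess μ x ν) (f : SimpleFunc S ENNReal) (hf : ν (Function.support f) < ⊤) :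
    ∫⁻ ω, expNeg (∑' k, f (x k ω)) ∂μ = expNeg (∫⁻ y, 1 - expNeg (f y) ∂ν) := by
  classical
  -- The value zero is left out: its level set may have infinite intensity, and it contributes
  -- nothing to either side.
  let s := f.range.filter (· ≠ 0)
  have h1 (y : S) : f y = ∑ a : s, (f ⁻¹' {(a : ENNReal)}).indicator 1 y * (a : ENNReal) := by
    rw [Finset.sum_coe_sort s (fun a => (f ⁻¹' {a}).indicator 1 y * a)]
    by_cases hy : f y = 0
    · rw [hy, Finset.sum_eq_zero]
      intro a ha
      rw [Set.indicator_of_notMem, zero_mul]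
      simp only [Set.mem_preimage, hy, Set.mem_singleton_iff]
      exact (Finset.mem_filter.1 ha).2.symm
    · rw [Finset.sum_eq_single (f y)]
      · simp
      · intro a _ ha
        rw [Set.indicator_of_notMem, zero_mul]
        simpa using ha.symm
      · intro hn
        exact absurd (Finset.mem_filter.2 ⟨f.mem_range_self y, hy⟩) hn
  have h2 (ω : Ω) : ∑' k, f (x k ω)
      = ∑ a : s, (count x (f ⁻¹' {(a : ENNReal)}) ω : ENNReal) * (a : ENNReal) := by
    simp_rw [coe_count, ← ENNReal.tsum_mul_right]
    rw [← Summable.tsum_finsetSum fun _ _ => ENNReal.summable]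
    exact tsum_congr fun k => h1 _
  simp_rw [h2]
  rw [h.lintegral_expNeg_sum (fun a : s => f ⁻¹' {(a : ENNReal)}) (fun a => f.measurableSet_fiber _)]
  · congr 1
    have h3 : ∫⁻ y, 1 - expNeg (f y) ∂ν = ∑ a ∈ f.range, (1 - expNeg a) * ν (f ⁻¹' {a}) := by
      rw [← SimpleFunc.map_lintegral, ← SimpleFunc.lintegral_eq_lintegral]
      rfl
    rw [h3, Finset.sum_coe_sort s (fun a => ν (f ⁻¹' {a}) * (1 - expNeg a)), Finset.sum_filter]
    refine Finset.sum_congr rfl fun a _ => ?_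
    rcases eq_or_ne a 0 with rfl | ha
    · simp
    · rw [if_pos ha, mul_comm]
  · intro a
    refine (measure_mono ?_).trans_lt hf
    intro y hy
    rw [Function.mem_support, show f y = a from hy]
    exact (Finset.mem_filter.1 a.2).2
  · intro a b hab
    refine Disjoint.preimage _ ?_
    simpa using fun h => hab (Subtype.ext h)

/-- Simple functions cut off to sets of finite intensity increase to `f`. The left side passes to
the limit by domination by `1`, the right side by monotone convergence. -/
lemma IsPoissonProcess.laplace [IsProbabilityMeasure μ] [SigmaFinite ν]
    (h : IsPoissonProcess μ x ν) {f : S → ENNReal} (hf : Measurable f) :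
    ∫⁻ ω, expNeg (∑' k, f (x k ω)) ∂μ = expNeg (∫⁻ y, 1 - expNeg (f y) ∂ν) := by
  let g (n : ℕ) : SimpleFunc S ENNReal :=
    (SimpleFunc.eapprox f n).restrict (spanningSets ν n)
  have hg (n : ℕ) (y : S) : g n y = (spanningSets ν n).indicator (SimpleFunc.eapprox f n) y :=
    congrFun (SimpleFunc.coe_restrict _ (measurableSet_spanningSets ν n)) y
  have hmono (y : S) : Monotone fun n => g n y := by
    intro i j hij
    simp only [hg]
    refine (Set.indicator_le_indicator_of_subset (monotone_spanningSets ν hij) (by simp) y).trans ?_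
    exact Set.indicator_le_indicator (SimpleFunc.monotone_eapprox f hij y)
  have hlim (y : S) : Filter.Tendsto (fun n => g n y) Filter.atTop (nhds (f y)) := by
    refine (SimpleFunc.tendsto_eapprox hf y).congr' ?_
    obtain ⟨N, hN⟩ := Set.mem_iUnion.1 (iUnion_spanningSets ν ▸ Set.mem_univ y)
    filter_upwards [Filter.eventually_ge_atTop N] with n hn
    rw [hg, Set.indicator_of_mem (monotone_spanningSets ν hn hN)]
  have hsup (n : ℕ) : ν (Function.support (g n)) < ⊤ := by
    refine (measure_mono ?_).trans_lt (measure_spanningSets_lt_top ν n)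
    rw [show (g n : S → ENNReal) = _ from funext (hg n)]
    exact Set.support_indicator_subset
  have key := fun n => h.laplace_simpleFunc (g n) (hsup n)
  have hL : Filter.Tendsto (fun n => ∫⁻ ω, expNeg (∑' k, g n (x k ω)) ∂μ) Filter.atTop
      (nhds (∫⁻ ω, expNeg (∑' k, f (x k ω)) ∂μ)) := by
    refine tendsto_lintegral_of_dominated_convergence' (fun _ => 1) (fun n => ?_) (fun n => ?_)
      (by simp) ?_
    · exact (measurable_expNeg.comp (Measurable.tsum fun k =>
        (g n).measurable.comp (h.measurable k))).aemeasurable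
    · exact Filter.Eventually.of_forall fun _ => expNeg_le_one _
    · refine Filter.Eventually.of_forall fun ω => (continuous_expNeg.tendsto _).comp ?_
      -- Sums over `k` are integrals against counting measure, so monotone convergence applies to
      -- them too.
      simp_rw [← MeasureTheory.lintegral_count]
      exact lintegral_tendsto_of_tendsto_of_monotone (fun n => .of_discrete)
        (Filter.Eventually.of_forall fun k => hmono _)
        (Filter.Eventually.of_forall fun k => hlim _)
  have hR : Filter.Tendsto (fun n => expNeg (∫⁻ y, 1 - expNeg (g n y) ∂ν)) Filter.atTop
      (nhds (expNeg (∫⁻ y, 1 - expNeg (f y) ∂ν))) := by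
    refine (continuous_expNeg.tendsto _).comp ?_
    refine lintegral_tendsto_of_tendsto_of_monotone (fun n => ?_)
      (Filter.Eventually.of_forall fun y => ?_) (Filter.Eventually.of_forall fun y => ?_)
    · exact (measurable_const.sub (measurable_expNeg.comp (g n).measurable)).aemeasurable
    · exact fun i j hij => tsub_le_tsub_left (expNeg_antitone (hmono y hij)) 1
    · exact ENNReal.Tendsto.sub tendsto_const_nhds
        ((continuous_expNeg.tendsto _).comp (hlim y)) (Or.inl ENNReal.one_ne_top)
  simp_rw [key] at hL
  exact tendsto_nhds_unique hL hR

end Poisson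

/-! ### Independence and independent marking -/

lemma indepFun_of_measurable {Ω A B : Type*} [mΩ : MeasurableSpace Ω] [MeasurableSpace A]
    [MeasurableSpace B] {μ : Measure Ω} {m₁ m₂ : MeasurableSpace Ω} {Z : Ω → A} {T : Ω → B}
    (h : Indep m₁ m₂ μ) (hZ : Measurable[m₁] Z) (hT : Measurable[m₂] T) : IndepFun Z T μ :=
  (IndepFun_iff_Indep Z T μ).2 (indep_of_indep_of_le_left
    (indep_of_indep_of_le_right h hT.comap_le) hZ.comap_le)

section Independence

variable {Ω A B S : Type*} [mΩ : MeasurableSpace Ω] [MeasurableSpace A] [MeasurableSpace B]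
  [MeasurableSpace S] {μ : Measure Ω} [IsProbabilityMeasure μ]

lemma lintegral_comp_of_indepFun {Z : Ω → A} {T : Ω → B} (hZ : Measurable Z) (hT : Measurable T)
    (h : IndepFun Z T μ) {G : A × B → ENNReal} (hG : Measurable G) :
    ∫⁻ ω, G (Z ω, T ω) ∂μ = ∫⁻ ω, ∫⁻ ω', G (Z ω, T ω') ∂μ ∂μ := by
  rw [← lintegral_map (μ := μ) hG (hZ.prodMk hT), h.map_prod_eq_prod_map_map hZ.aemeasurable
    hT.aemeasurable, lintegral_prod _ hG.aemeasurable,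
    lintegral_map (hG.lintegral_prod_right') hZ]
  refine lintegral_congr fun ω => ?_
  exact lintegral_map (hG.comp measurable_prodMk_left) hT

/-- The last label `T n` is independent of `F n`, which carries `X` and all earlier labels, so it
can be averaged with these held fixed. The weight `H` is arbitrary so that the induction can absorb
the averaged factor, a function of `X` alone. -/
lemma lintegral_prod_of_indep {F : ℕ → MeasurableSpace Ω} (hF : ∀ n, F n ≤ mΩ)
    {X : Ω → A} {T : ℕ → Ω → B} (hX : ∀ n, Measurable[F n] X)
    (hT : ∀ n, ∀ k < n, Measurable[F n] (T k)) (hT' : ∀ n, Measurable (T n))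
    (hind : ∀ n, Indep (F n) (MeasurableSpace.comap (T n) inferInstance) μ)
    {G : ℕ → A × B → ENNReal} (hG : ∀ k, Measurable (G k)) (n : ℕ) :
    ∀ {H : A → ENNReal}, Measurable H →
    ∫⁻ ω, H (X ω) * ∏ k ∈ Finset.range n, G k (X ω, T k ω) ∂μ
      = ∫⁻ ω, H (X ω) * ∏ k ∈ Finset.range n, ∫⁻ ω', G k (X ω, T k ω') ∂μ ∂μ := by
  induction n with
  | zero => simp
  | succ n ih =>
    intro H hH
    have hY : Measurable[F n]
        (fun ω => H (X ω) * ∏ k ∈ Finset.range n, G k (X ω, T k ω)) := by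
      refine Measurable.mul (hH.comp (hX n)) (Finset.measurable_fun_prod _ fun k hk => ?_)
      exact (hG k).comp ((hX n).prodMk (hT n k (Finset.mem_range.1 hk)))
    have hZ := hY.prodMk (hX n)
    have hi : IndepFun _ (T n) μ :=
      indepFun_of_measurable (hind n) hZ (comap_measurable (T n))
    have hφ : Measurable fun a => ∫⁻ ω', G n (a, T n ω') ∂μ :=
      Measurable.lintegral_prod_right' (f := fun z : A × Ω => G n (z.1, T n z.2))
        ((hG n).comp (measurable_fst.prodMk ((hT' n).comp measurable_snd)))
    have h1 := lintegral_comp_of_indepFun (G := fun z : (ENNReal × A) × B => z.1.1 * G n (z.1.2, z.2))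
      (hZ.mono (hF n) le_rfl) (hT' n) hi
      (measurable_fst.fst.mul ((hG n).comp (measurable_fst.snd.prodMk measurable_snd)))
    have h2 := ih (H := fun a => H a * ∫⁻ ω', G n (a, T n ω') ∂μ) (hH.mul hφ)
    simp only at h1
    simp_rw [Finset.prod_range_succ, ← mul_assoc]
    rw [h1]
    calc _ = ∫⁻ ω, (H (X ω) * ∫⁻ ω', G n (X ω, T n ω') ∂μ)
          * ∏ k ∈ Finset.range n, G k (X ω, T k ω) ∂μ := by
          refine lintegral_congr fun ω => ?_
          have hm : Measurable fun ω' => G n (X ω, T n ω') :=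
            (hG n).comp (measurable_const.prodMk (hT' n))
          rw [lintegral_const_mul _ hm]
          ring
      _ = _ := by
          rw [h2]
          refine lintegral_congr fun ω => ?_
          ring

/-- The Laplace functional of an independently marked Poisson process. -/
lemma IsPoissonProcess.laplace_marked {x : ℕ → Ω → S} {ν : Measure S} [SigmaFinite ν]
    (h : IsPoissonProcess μ x ν) {F : ℕ → MeasurableSpace Ω} (hF : ∀ n, F n ≤ mΩ)
    {T : ℕ → Ω → B} (hx : ∀ n k, Measurable[F n] (x k))
    (hT : ∀ n, ∀ k < n, Measurable[F n] (T k))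
    (hind : ∀ n, Indep (F n) (MeasurableSpace.comap (T n) inferInstance) μ)
    (hid : ∀ n, IdentDistrib (T n) (T 0) μ μ) (hT' : ∀ n, Measurable (T n))
    {W : S × B → ENNReal} (hW : Measurable W) :
    ∫⁻ ω, expNeg (∑' k, W (x k ω, T k ω)) ∂μ
      = expNeg (∫⁻ y, ∫⁻ ω, 1 - expNeg (W (y, T 0 ω)) ∂μ ∂ν) := by
  -- The mean factor of a point at `y`. After averaging, the labelled process behaves like an
  -- unlabelled one with `f = -log φ`, for which `1 - exp (-f) = 1 - φ`.
  let φ (y : S) : ENNReal := ∫⁻ ω, expNeg (W (y, T 0 ω)) ∂μ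
  have hWT : Measurable fun z : S × Ω => expNeg (W (z.1, T 0 z.2)) :=
    measurable_expNeg.comp (hW.comp (measurable_fst.prodMk ((hT' 0).comp measurable_snd)))
  have hφ : Measurable φ := Measurable.lintegral_prod_right' hWT
  have hφ1 (y : S) : φ y ≤ 1 := by
    refine (lintegral_mono fun ω => expNeg_le_one _).trans ?_
    simp
  have hφk (y : S) (k : ℕ) : ∫⁻ ω, expNeg (W (y, T k ω)) ∂μ = φ y :=
    ((hid k).comp (u := fun b => expNeg (W (y, b)))
      (measurable_expNeg.comp (hW.comp measurable_prodMk_left))).lintegral_eq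
  have hWk (k : ℕ) : Measurable fun z : (ℕ → S) × B => expNeg (W (z.1 k, z.2)) :=
    measurable_expNeg.comp
      (hW.comp (((measurable_pi_apply k).comp measurable_fst).prodMk measurable_snd))
  have key (n : ℕ) : ∫⁻ ω, ∏ k ∈ Finset.range n, expNeg (W (x k ω, T k ω)) ∂μ
      = ∫⁻ ω, ∏ k ∈ Finset.range n, expNeg (negLog (φ (x k ω))) ∂μ := by
    have := lintegral_prod_of_indep hF (X := fun ω k => x k ω)
      (fun n => @measurable_pi_lambda _ _ _ (F n) _ _ (hx n)) hT hT' hind hWk n (H := fun _ => 1) measurable_const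
    simp_rw [expNeg_negLog (hφ1 _)]
    simpa [hφk] using this
  have hL : Filter.Tendsto
      (fun n => ∫⁻ ω, ∏ k ∈ Finset.range n, expNeg (W (x k ω, T k ω)) ∂μ) Filter.atTop
      (nhds (∫⁻ ω, expNeg (∑' k, W (x k ω, T k ω)) ∂μ)) := by
    refine tendsto_lintegral_of_dominated_convergence (fun _ => 1) (fun n => ?_) (fun n => ?_)
      (by simp) (Filter.Eventually.of_forall fun ω => tendsto_prod_expNeg _)
    · exact Finset.measurable_fun_prod _ fun k _ =>
        measurable_expNeg.comp (hW.comp ((h.measurable k).prodMk (hT' k)))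
    · exact Filter.Eventually.of_forall fun _ => Finset.prod_le_one' fun _ _ => expNeg_le_one _
  have hR : Filter.Tendsto
      (fun n => ∫⁻ ω, ∏ k ∈ Finset.range n, expNeg (negLog (φ (x k ω))) ∂μ) Filter.atTop
      (nhds (∫⁻ ω, expNeg (∑' k, negLog (φ (x k ω))) ∂μ)) := by
    refine tendsto_lintegral_of_dominated_convergence (fun _ => 1) (fun n => ?_) (fun n => ?_)
      (by simp) (Filter.Eventually.of_forall fun ω => tendsto_prod_expNeg _)
    · exact Finset.measurable_fun_prod _ fun k _ =>
        measurable_expNeg.comp (measurable_negLog.comp (hφ.comp (h.measurable k)))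
    · exact Filter.Eventually.of_forall fun _ => Finset.prod_le_one' fun _ _ => expNeg_le_one _
  simp_rw [key] at hL
  rw [tendsto_nhds_unique hL hR, h.laplace (f := fun y => negLog (φ y)) (measurable_negLog.comp hφ)]
  congr 1
  refine lintegral_congr fun y => ?_
  have hm : Measurable fun ω => expNeg (W (y, T 0 ω)) := hWT.comp measurable_prodMk_left
  rw [expNeg_negLog (hφ1 y), lintegral_sub hm ((hφ1 y).trans_lt ENNReal.one_lt_top).ne
    (Filter.Eventually.of_forall fun _ => expNeg_le_one _)]
  simp [φ]

end Independence

/-! ### Sources of randomness and the label of a transmitter -/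

namespace Network

/-- The σ-algebra generated by a set of sources of randomness. -/
@[reducible] def sigmaOf {Ω : Type*} {M : ℕ} (N : Network Ω M) (S : Set (Source M)) :
    MeasurableSpace Ω := ⨆ i ∈ S, N.sigma i

lemma sigma_le_sigmaOf {Ω : Type*} {M : ℕ} (N : Network Ω M) {S : Set (Source M)} {i : Source M}
    (hi : i ∈ S) : N.sigma i ≤ N.sigmaOf S :=
  le_iSup₂ (f := fun i (_ : i ∈ S) => N.sigma i) i hi

section Measurability

variable {Ω : Type*} {M : ℕ} (N : Network Ω M) {S : Set (Source M)}

lemma measurable_sigmaOf_pos (h : .pos ∈ S) (k : ℕ) : Measurable[N.sigmaOf S] (N.pos k) :=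
  ((measurable_pi_apply k).comp (comap_measurable (fun ω k => N.pos k ω))).mono
    (N.sigma_le_sigmaOf h) le_rfl

lemma measurable_sigmaOf_mark {k : ℕ} (h : .mark k ∈ S) : Measurable[N.sigmaOf S] (N.mark k) :=
  (comap_measurable (N.mark k)).mono (N.sigma_le_sigmaOf h) le_rfl

lemma measurable_sigmaOf_power {k : ℕ} (h : .power k ∈ S) :
    Measurable[N.sigmaOf S] (N.power k) :=
  (comap_measurable (N.power k)).mono (N.sigma_le_sigmaOf h) le_rfl

lemma measurable_sigmaOf_gain {k : ℕ} (h : .gain k ∈ S) :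
    Measurable[N.sigmaOf S] fun ω => ‖N.gain k ω‖ ^ 2 :=
  Measurable.mono (((measurable_norm.pow_const 2 : Measurable fun z : ℂ => ‖z‖ ^ 2)).comp
    (comap_measurable (N.gain k))) (N.sigma_le_sigmaOf h) le_rfl

lemma measurable_sigmaOf_dist {m : Fin M} (h : .cellPos m ∈ S) :
    Measurable[N.sigmaOf S] (N.dist m) :=
  Measurable.mono ((measurable_norm (α := Plane)).comp
    (comap_measurable (N.cellPos m))) (N.sigma_le_sigmaOf h) le_rfl

lemma measurable_sigmaOf_cellPower {m : Fin M} (h : .cellPower m ∈ S) :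
    Measurable[N.sigmaOf S] (N.cellPower m) :=
  (comap_measurable (N.cellPower m)).mono (N.sigma_le_sigmaOf h) le_rfl

lemma measurable_sigmaOf_cellGain {m : Fin M} (h : .cellGain m ∈ S) :
    Measurable[N.sigmaOf S] fun ω => ‖N.cellGain m ω‖ ^ 2 :=
  Measurable.mono (((measurable_norm.pow_const 2 : Measurable fun z : ℂ => ‖z‖ ^ 2)).comp
    (comap_measurable (N.cellGain m))) (N.sigma_le_sigmaOf h) le_rfl

lemma measurable_sigmaOf_X {m : Fin M} (α : ℝ) (h₁ : .cellPos m ∈ S) (h₂ : .cellPower m ∈ S) :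
    Measurable[N.sigmaOf S] (N.X α m) :=
  Measurable.div ((N.measurable_sigmaOf_dist h₁).pow_const α) (N.measurable_sigmaOf_cellPower h₂)

/-- Mark, power and fading gain of a D2D transmitter. -/
def label (N : Network Ω M) (k : ℕ) (ω : Ω) : Fin M × ℝ × ℝ :=
  (N.mark k ω, N.power k ω, ‖N.gain k ω‖ ^ 2)

lemma measurable_sigmaOf_label {k : ℕ} (h₁ : .mark k ∈ S) (h₂ : .power k ∈ S)
    (h₃ : .gain k ∈ S) : Measurable[N.sigmaOf S] (N.label k) :=
  (N.measurable_sigmaOf_mark h₁).prodMk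
    ((N.measurable_sigmaOf_power h₂).prodMk (N.measurable_sigmaOf_gain h₃))

/-- The contribution to the interference of a transmitter with given position and label. -/
def kernel (α : ℝ) (m : Fin M) (z : Plane × Fin M × ℝ × ℝ) : ENNReal :=
  if z.2.1 = m then ENNReal.ofReal (z.2.2.1 * z.2.2.2 * ‖z.1‖ ^ (-α)) else 0

lemma measurable_kernel (α : ℝ) (m : Fin M) : Measurable (kernel α m) :=
  Measurable.ite (measurable_snd.fst (measurableSet_singleton m)) (by fun_prop) measurable_const

lemma interference_eq (α : ℝ) (m : Fin M) :
    N.interference α m = fun ω => ∑' k, kernel α m (N.pos k ω, N.label k ω) := rfl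

lemma measurable_sigmaOf_interference (α : ℝ) (m : Fin M) (h₀ : .pos ∈ S)
    (h₁ : ∀ k, .mark k ∈ S) (h₂ : ∀ k, .power k ∈ S) (h₃ : ∀ k, .gain k ∈ S) :
    Measurable[N.sigmaOf S] (N.interference α m) := by
  rw [interference_eq]
  let := N.sigmaOf S
  exact Measurable.tsum fun k => (measurable_kernel α m).comp
    ((N.measurable_sigmaOf_pos h₀ k).prodMk
      (N.measurable_sigmaOf_label (h₁ k) (h₂ k) (h₃ k)))

end Measurability

namespace IsModel

variable {Ω : Type*} {M : ℕ} [mΩ : MeasurableSpace Ω] {N : Network Ω M} {μ : Measure Ω}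
  {lam R : ℝ}

lemma sigma_le (hN : N.IsModel μ lam R) (i : Source M) : N.sigma i ≤ mΩ := by
  cases i with
  | pos => exact (measurable_pi_lambda _ hN.poisson.measurable).comap_le
  | mark k => exact (hN.mark_measurable k).comap_le
  | power k => exact (hN.power_measurable k).comap_le
  | gain k => exact (hN.gain_measurable k).comap_le
  | cellPos m => exact (hN.cellPos_measurable m).comap_le
  | cellPower m => exact (hN.cellPower_measurable m).comap_le
  | cellGain m => exact (hN.cellGain_measurable m).comap_le

lemma sigmaOf_le (hN : N.IsModel μ lam R) (S : Set (Source M)) : N.sigmaOf S ≤ mΩ :=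
  iSup₂_le fun i _ => hN.sigma_le i

/-- The independence statements about network quantities rest on this: each side is measurable with
respect to its own set of sources, and the two sets are disjoint. -/
lemma indep_sigmaOf (hN : N.IsModel μ lam R) {S T : Set (Source M)} (h : Disjoint S T) :
    Indep (N.sigmaOf S) (N.sigmaOf T) μ :=
  indep_iSup_of_disjoint hN.sigma_le hN.indep h

lemma measurable_label (hN : N.IsModel μ lam R) (k : ℕ) : Measurable (N.label k) :=
  (N.measurable_sigmaOf_label (Set.mem_univ _) (Set.mem_univ _) (Set.mem_univ _)).mono
    (hN.sigmaOf_le _) le_rfl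

lemma measurable_X (hN : N.IsModel μ lam R) (α : ℝ) (m : Fin M) : Measurable (N.X α m) :=
  (N.measurable_sigmaOf_X α (Set.mem_univ _) (Set.mem_univ _)).mono (hN.sigmaOf_le _) le_rfl

lemma measurable_dist (hN : N.IsModel μ lam R) (m : Fin M) : Measurable (N.dist m) :=
  (N.measurable_sigmaOf_dist (Set.mem_univ _)).mono (hN.sigmaOf_le _) le_rfl

lemma measurable_gain_sq (hN : N.IsModel μ lam R) (k : ℕ) :
    Measurable fun ω => ‖N.gain k ω‖ ^ 2 :=
  (hN.gain_measurable k).norm.pow_const 2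

lemma measurable_interference (hN : N.IsModel μ lam R) (α : ℝ) (m : Fin M) :
    Measurable (N.interference α m) :=
  (N.measurable_sigmaOf_interference α m (Set.mem_univ _) (fun _ => Set.mem_univ _)
    (fun _ => Set.mem_univ _) (fun _ => Set.mem_univ _)).mono (hN.sigmaOf_le _) le_rfl

lemma indepFun_power_gain (hN : N.IsModel μ lam R) (k : ℕ) :
    IndepFun (N.power k) (fun ω => ‖N.gain k ω‖ ^ 2) μ :=
  indepFun_of_measurable (hN.indep_sigmaOf (S := {.power k}) (T := {.gain k}) (by simp))
    (N.measurable_sigmaOf_power (by simp)) (N.measurable_sigmaOf_gain (by simp))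

lemma indepFun_mark_power_gain (hN : N.IsModel μ lam R) (k : ℕ) :
    IndepFun (N.mark k) (fun ω => (N.power k ω, ‖N.gain k ω‖ ^ 2)) μ :=
  indepFun_of_measurable (hN.indep_sigmaOf (S := {.mark k}) (T := {.power k, .gain k}) (by simp))
    (N.measurable_sigmaOf_mark (by simp))
    ((N.measurable_sigmaOf_power (by simp)).prodMk (N.measurable_sigmaOf_gain (by simp)))

lemma identDistrib_label [IsProbabilityMeasure μ] (hN : N.IsModel μ lam R) (k : ℕ) :
    IdentDistrib (N.label k) (N.label 0) μ μ := by
  have hg : IdentDistrib (fun ω => ‖N.gain k ω‖ ^ 2) (fun ω => ‖N.gain 0 ω‖ ^ 2) μ μ :=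
    ⟨(hN.measurable_gain_sq k).aemeasurable, (hN.measurable_gain_sq 0).aemeasurable,
      (hN.gain_law k).trans (hN.gain_law 0).symm⟩
  exact (hN.mark_ident k).prodMk
    ((hN.power_ident k).prodMk hg (hN.indepFun_power_gain k) (hN.indepFun_power_gain 0))
    (hN.indepFun_mark_power_gain k) (hN.indepFun_mark_power_gain 0)

lemma lintegral_gain_rpow (hN : N.IsModel μ lam R) (k : ℕ) {a : ℝ} (ha : -1 < a) :
    ∫⁻ ω, ENNReal.ofReal ((‖N.gain k ω‖ ^ 2) ^ a) ∂μ = ENNReal.ofReal (Real.Gamma (1 + a)) := by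
  rw [← lintegral_rpow_expMeasure_one ha, ← hN.gain_law k,
    lintegral_map (by fun_prop) (hN.measurable_gain_sq k)]

lemma lintegral_power_rpow (hN : N.IsModel μ lam R) {α : ℝ}
    (hp : Integrable (fun ω => N.power 0 ω ^ (2 / α)) μ) :
    ∫⁻ ω, ENNReal.ofReal (N.power 0 ω ^ (2 / α)) ∂μ = ENNReal.ofReal (N.powerMoment μ α) := by
  rw [powerMoment, ofReal_integral_eq_lintegral_ofReal hp]
  filter_upwards [hN.power_nonneg 0] with ω hω
  exact Real.rpow_nonneg hω _

lemma powerMoment_nonneg (hN : N.IsModel μ lam R) (α : ℝ) : 0 ≤ N.powerMoment μ α := by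
  refine integral_nonneg_of_ae ?_
  filter_upwards [hN.power_nonneg 0] with ω hω
  exact Real.rpow_nonneg hω _

lemma measurableSet_mark_eq (hN : N.IsModel μ lam R) (k : ℕ) (m : Fin M) :
    MeasurableSet {ω | N.mark k ω = m} :=
  hN.mark_measurable k (measurableSet_singleton m)

/-- Mark, power and gain are independent, so the mean factors; the exponential moment of order `2/α`
supplies `Γ(1 + 2/α)`. -/
lemma lintegral_mark_power_gain [IsProbabilityMeasure μ] (hN : N.IsModel μ lam R) {α : ℝ}
    (hα : 0 < α) (hp : Integrable (fun ω => N.power 0 ω ^ (2 / α)) μ) (m : Fin M) :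
    ∫⁻ ω, {ω | N.mark 0 ω = m}.indicator 1 ω * (ENNReal.ofReal (N.power 0 ω ^ (2 / α))
        * ENNReal.ofReal ((‖N.gain 0 ω‖ ^ 2) ^ (2 / α))) ∂μ
      = ENNReal.ofReal (N.markProb μ m * N.powerMoment μ α * Real.Gamma (1 + 2 / α)) := by
  have hδ : 0 < 2 / α := by positivity
  have h1 : IndepFun (fun ω => {ω | N.mark 0 ω = m}.indicator (1 : Ω → ENNReal) ω)
      (fun ω => ENNReal.ofReal (N.power 0 ω ^ (2 / α))
        * ENNReal.ofReal ((‖N.gain 0 ω‖ ^ 2) ^ (2 / α))) μ := (hN.indepFun_mark_power_gain 0).comp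
    (φ := fun i : Fin M => ({m} : Set (Fin M)).indicator (1 : Fin M → ENNReal) i)
    (ψ := fun z : ℝ × ℝ => ENNReal.ofReal (z.1 ^ (2 / α)) * ENNReal.ofReal (z.2 ^ (2 / α)))
    .of_discrete (by fun_prop)
  have h2 : IndepFun (fun ω => ENNReal.ofReal (N.power 0 ω ^ (2 / α)))
      (fun ω => ENNReal.ofReal ((‖N.gain 0 ω‖ ^ 2) ^ (2 / α))) μ := (hN.indepFun_power_gain 0).comp
    (φ := fun z : ℝ => ENNReal.ofReal (z ^ (2 / α)))
    (ψ := fun z : ℝ => ENNReal.ofReal (z ^ (2 / α))) (by fun_prop) (by fun_prop)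
  have hg := ((hN.measurable_gain_sq 0).pow_const (2 / α)).ennreal_ofReal
  have hpow := ((hN.power_measurable 0).pow_const (2 / α)).ennreal_ofReal
  have hpg : Measurable fun ω => ENNReal.ofReal (N.power 0 ω ^ (2 / α))
      * ENNReal.ofReal ((‖N.gain 0 ω‖ ^ 2) ^ (2 / α)) := hpow.mul hg
  rw [lintegral_mul_eq_lintegral_mul_lintegral_of_indepFun''
    ((measurable_one.indicator (hN.measurableSet_mark_eq 0 m)).aemeasurable)
    hpg.aemeasurable h1,
    lintegral_mul_eq_lintegral_mul_lintegral_of_indepFun'' hpow.aemeasurable hg.aemeasurable h2,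
    lintegral_indicator_one (hN.measurableSet_mark_eq 0 m), hN.lintegral_power_rpow hp,
    hN.lintegral_gain_rpow 0 (by linarith), markProb, mul_assoc,
    ENNReal.ofReal_mul measureReal_nonneg, ENNReal.ofReal_mul (hN.powerMoment_nonneg α),
    ofReal_measureReal]

end IsModel

end Network

/-! ### The Laplace transform of the interference -/

lemma nsinc_eq {x : ℝ} (h0 : x ≠ 0) : nsinc x = Real.sin (Real.pi * x) / (Real.pi * x) :=
  Real.sinc_of_ne_zero (mul_ne_zero Real.pi_ne_zero h0)

lemma nsinc_pos {x : ℝ} (h0 : 0 < x) (h1 : x < 1) : 0 < nsinc x := by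
  rw [nsinc_eq h0.ne']
  have : 0 < Real.sin (Real.pi * x) :=
    Real.sin_pos_of_pos_of_lt_pi (by positivity) (by nlinarith [Real.pi_pos])
  positivity

/-- Euler's reflection formula after `Γ(1 + x) = x Γ(x)`. -/
lemma Gamma_one_add_mul_Gamma_one_sub {x : ℝ} (h0 : 0 < x) :
    Real.Gamma (1 + x) * Real.Gamma (1 - x) = 1 / nsinc x := by
  rw [add_comm, Real.Gamma_add_one h0.ne', mul_assoc, Real.Gamma_mul_Gamma_one_sub,
    nsinc_eq h0.ne', one_div_div]
  ring

namespace Network.IsModel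

variable {Ω : Type*} {M : ℕ} [mΩ : MeasurableSpace Ω] {N : Network Ω M} {μ : Measure Ω}
  {lam R : ℝ}

/-- For a fixed label this is the planar integral with `c = s p g`, whose power `2/α` splits over
the factors. A wrong mark makes the kernel vanish, which is how thinning enters. -/
lemma lintegral_one_sub_kernel {α : ℝ} (hα : 2 < α) (hlam : 0 ≤ lam) {s : ℝ} (hs : 0 ≤ s)
    (m i : Fin M) {p g : ℝ} (hp : 0 ≤ p) (hg : 0 ≤ g) :
    ∫⁻ y : Plane, 1 - expNeg (ENNReal.ofReal s * kernel α m (y, i, p, g))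
        ∂(ENNReal.ofReal lam • volume)
      = ENNReal.ofReal (lam * Real.pi * s ^ (2 / α) * Real.Gamma (1 - 2 / α))
        * (({m} : Set (Fin M)).indicator 1 i * (ENNReal.ofReal (p ^ (2 / α))
          * ENNReal.ofReal (g ^ (2 / α)))) := by
  by_cases hi : i = m
  · have h (y : Plane) : ENNReal.ofReal s * kernel α m (y, i, p, g)
        = ENNReal.ofReal ((s * p * g) * ‖y‖ ^ (-α)) := by
      rw [kernel, if_pos hi, ← ENNReal.ofReal_mul hs]
      ring_nf
    have hΓ : 0 < Real.Gamma (1 - 2 / α) := by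
      refine Real.Gamma_pos_of_pos (sub_pos.2 ?_)
      rwa [div_lt_one (by linarith)]
    simp_rw [h]
    rw [lintegral_smul_measure, lintegral_one_sub_expNeg_norm hα (by positivity),
      Set.indicator_of_mem (by simpa using hi), Pi.one_apply, one_mul,
      ← ENNReal.ofReal_mul (by positivity), ← ENNReal.ofReal_mul (by positivity), smul_eq_mul,
      ← ENNReal.ofReal_mul hlam, Real.mul_rpow (by positivity) hg, Real.mul_rpow hs hp]
    ring_nf
  · simp [kernel, hi]

/-- The Laplace transform of the interference. -/
lemma lintegral_expNeg_interference [IsProbabilityMeasure μ] (hN : N.IsModel μ lam R)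
    (hlam : 0 < lam) {α : ℝ} (hα : 2 < α)
    (hp : Integrable (fun ω => N.power 0 ω ^ (2 / α)) μ) (m : Fin M) {s : ℝ} (hs : 0 ≤ s) :
    ∫⁻ ω, expNeg (ENNReal.ofReal s * N.interference α m ω) ∂μ
      = ENNReal.ofReal
        (Real.exp (-theta α lam s (N.markProb μ m) (N.powerMoment μ α))) := by
  have hα0 : 0 < α := by linarith
  have hδ0 : 0 < 2 / α := by positivity
  have hδ1 : 2 / α < 1 := by rwa [div_lt_one hα0]
  have hW : Measurable fun z : Plane × Fin M × ℝ × ℝ => ENNReal.ofReal s * kernel α m z :=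
    (measurable_kernel α m).const_mul _
  -- All positions together with the labels of the first `n` transmitters; label `n` draws on none
  -- of these sources.
  let before (n : ℕ) : Set (Source M) :=
    {i | i = .pos ∨ ∃ k < n, i = .mark k ∨ i = .power k ∨ i = .gain k}
  have : SigmaFinite (ENNReal.ofReal lam • volume : Measure Plane) :=
    inferInstanceAs (SigmaFinite (lam.toNNReal • volume : Measure Plane))
  have h1 := hN.poisson.laplace_marked (F := fun n => N.sigmaOf (before n))
    (fun n => hN.sigmaOf_le _) (T := N.label)
    (fun n k => N.measurable_sigmaOf_pos (Or.inl rfl) k)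
    (fun n k hk => N.measurable_sigmaOf_label (Or.inr ⟨k, hk, by simp⟩)
      (Or.inr ⟨k, hk, by simp⟩) (Or.inr ⟨k, hk, by simp⟩))
    (fun n => indep_of_indep_of_le_right
      (hN.indep_sigmaOf (T := {.mark n, .power n, .gain n}) (by
        rw [Set.disjoint_right]
        rintro i (rfl | rfl | rfl) (h | ⟨k, hk, h⟩) <;> simp at h <;> omega))
      (N.measurable_sigmaOf_label (by simp) (by simp) (by simp)).comap_le)
    hN.identDistrib_label hN.measurable_label hW
  have h2 (ω : Ω) : ENNReal.ofReal s * N.interference α m ω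
      = ∑' k, ENNReal.ofReal s * kernel α m (N.pos k ω, N.label k ω) := by
    rw [interference_eq, ENNReal.tsum_mul_left]
  simp_rw [h2]
  -- The plane is integrated first, at fixed label, leaving only moments of the label.
  rw [h1, lintegral_lintegral_swap]
  · have h3 : ∀ᵐ ω ∂μ, ∫⁻ y : Plane, 1 - expNeg (ENNReal.ofReal s
          * kernel α m (y, N.label 0 ω)) ∂(ENNReal.ofReal lam • volume)
        = ENNReal.ofReal (lam * Real.pi * s ^ (2 / α) * Real.Gamma (1 - 2 / α))
          * ({ω | N.mark 0 ω = m}.indicator 1 ω * (ENNReal.ofReal (N.power 0 ω ^ (2 / α))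
            * ENNReal.ofReal ((‖N.gain 0 ω‖ ^ 2) ^ (2 / α)))) := by
      filter_upwards [hN.power_nonneg 0] with ω hω
      exact lintegral_one_sub_kernel hα hlam.le hs m _ hω (by positivity)
    have hm1 := measurable_one.indicator (hN.measurableSet_mark_eq 0 m) (f := (1 : Ω → ENNReal))
    have hg := ((hN.measurable_gain_sq 0).pow_const (2 / α)).ennreal_ofReal
    have hpow := hN.power_measurable 0
    have hΓ : 0 < Real.Gamma (1 - 2 / α) := Real.Gamma_pos_of_pos (sub_pos.2 hδ1)
    have hΓ' : 0 < Real.Gamma (1 + 2 / α) := Real.Gamma_pos_of_pos (by positivity)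
    have hq : 0 ≤ N.markProb μ m := measureReal_nonneg
    have he := hN.powerMoment_nonneg α
    rw [lintegral_congr_ae h3, lintegral_const_mul _ (by fun_prop),
      hN.lintegral_mark_power_gain hα0 hp m, ← ENNReal.ofReal_mul (by positivity),
      expNeg_ofReal (by positivity)]
    congr 3
    have hG := Gamma_one_add_mul_Gamma_one_sub hδ0
    rw [theta, div_eq_mul_one_div _ (nsinc _), ← hG]
    ring
  · exact (measurable_const.sub (measurable_expNeg.comp (hW.comp (measurable_fst.prodMk
      ((hN.measurable_label 0).comp measurable_snd))))).aemeasurable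

end Network.IsModel

/-! ### The coverage probability -/

/-- Conditionally on `Z`, the event is an exponential tail. -/
lemma measure_le_ofReal_of_exp {Ω : Type*} [MeasurableSpace Ω] {μ : Measure Ω}
    [IsProbabilityMeasure μ] {Z : Ω → ENNReal} {T : Ω → ℝ} (hZ : Measurable Z)
    (hT : Measurable T) (h : IndepFun Z T μ) (hlaw : μ.map T = expMeasure 1) :
    μ {ω | Z ω ≤ ENNReal.ofReal (T ω)} = ∫⁻ ω, expNeg (Z ω) ∂μ := by
  have hB : MeasurableSet {z : ENNReal × ℝ | z.1 ≤ ENNReal.ofReal z.2} :=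
    measurableSet_le measurable_fst measurable_snd.ennreal_ofReal
  have h1 : μ {ω | Z ω ≤ ENNReal.ofReal (T ω)}
      = μ.map (fun ω => (Z ω, T ω)) {z : ENNReal × ℝ | z.1 ≤ ENNReal.ofReal z.2} := by
    rw [Measure.map_apply (hZ.prodMk hT) hB]
    rfl
  rw [h1, h.map_prod_eq_prod_map_map hZ.aemeasurable hT.aemeasurable, hlaw,
    Measure.prod_apply hB, ← lintegral_map measurable_expNeg hZ]
  exact lintegral_congr fun v => expMeasure_one_setOf_le v

namespace Network

lemma measurable_sigmaOf_compl_cellGain {Ω : Type*} {M : ℕ} (N : Network Ω M) (α σ β : ℝ)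
    (m : Fin M) : Measurable[N.sigmaOf {.cellGain m}ᶜ] fun ω =>
      ENNReal.ofReal (β * N.X α m ω) * (N.interference α m ω + ENNReal.ofReal (σ ^ 2)) := by
  have hX := N.measurable_sigmaOf_X (S := {.cellGain m}ᶜ) (m := m) α (by simp) (by simp)
  have hI := N.measurable_sigmaOf_interference (S := {.cellGain m}ᶜ) α m (by simp) (by simp)
    (by simp) (by simp)
  let := N.sigmaOf {.cellGain m}ᶜ
  fun_prop

end Network

namespace Network.IsModel

variable {Ω : Type*} {M : ℕ} [mΩ : MeasurableSpace Ω] {N : Network Ω M} {μ : Measure Ω}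
  {lam R : ℝ}

lemma ae_dist_pos (hN : N.IsModel μ lam R) (m : Fin M) : ∀ᵐ ω ∂μ, 0 < N.dist m ω := by
  have h : ∀ᵐ x ∂(μ.map (N.cellPos m)), x ≠ 0 := by
    refine (hN.cellPos_uniform m).absolutelyContinuous.ae_le ?_
    exact ae_iff.2 (by simp)
  filter_upwards [ae_of_ae_map (hN.cellPos_measurable m).aemeasurable h] with ω hω
  exact norm_pos_iff.2 hω

lemma ae_cellGain_pos (hN : N.IsModel μ lam R) (m : Fin M) :
    ∀ᵐ ω ∂μ, 0 < ‖N.cellGain m ω‖ ^ 2 := by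
  have h : ∀ᵐ t ∂(μ.map fun ω => ‖N.cellGain m ω‖ ^ 2), 0 < t := by
    rw [hN.cellGain_law m, ae_iff]
    simp only [not_lt]
    exact (expMeasure_one_Iic le_rfl).trans (by simp)
  exact ae_of_ae_map ((hN.cellGain_measurable m).norm.pow_const 2).aemeasurable h

lemma ae_X_pos (hN : N.IsModel μ lam R) (α : ℝ) (m : Fin M) : ∀ᵐ ω ∂μ, 0 < N.X α m ω := by
  filter_upwards [hN.ae_dist_pos m, hN.cellPower_pos m] with ω h1 h2
  exact div_pos (Real.rpow_pos_of_pos h1 α) h2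

lemma ae_le_sinr_iff (hN : N.IsModel μ lam R) (α σ β : ℝ) (m : Fin M) :
    ∀ᵐ ω ∂μ, ENNReal.ofReal β ≤ N.sinr α σ m ω ↔
      ENNReal.ofReal (β * N.X α m ω) * (N.interference α m ω + ENNReal.ofReal (σ ^ 2))
        ≤ ENNReal.ofReal (‖N.cellGain m ω‖ ^ 2) := by
  filter_upwards [hN.ae_dist_pos m, hN.cellPower_pos m, hN.ae_cellGain_pos m, hN.ae_X_pos α m]
    with ω hd hp hg hX
  have hdα : 0 < N.dist m ω ^ α := Real.rpow_pos_of_pos hd α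
  have hX' : ENNReal.ofReal (N.X α m ω) ≠ 0 := by simpa using hX
  have hs : 0 < N.cellPower m ω * ‖N.cellGain m ω‖ ^ 2 * N.dist m ω ^ (-α) :=
    mul_pos (mul_pos hp hg) (Real.rpow_pos_of_pos hd _)
  -- A positive finite signal allows the denominator to be cleared even when it is `0` or `⊤`.
  -- Multiplying by `X` then isolates the fading gain.
  rw [sinr, ENNReal.le_div_iff_mul_le (Or.inr (by simpa using hs)) (Or.inr ENNReal.ofReal_ne_top),
    ← ENNReal.mul_le_mul_iff_right hX' ENNReal.ofReal_ne_top, ← ENNReal.ofReal_mul hX.le,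
    ← mul_assoc, ← ENNReal.ofReal_mul hX.le, mul_comm β]
  have : N.X α m ω * (N.cellPower m ω * ‖N.cellGain m ω‖ ^ 2 * N.dist m ω ^ (-α))
      = ‖N.cellGain m ω‖ ^ 2 := by
    rw [X, Real.rpow_neg hd.le]
    field_simp
  rw [this]

lemma ofReal_coverage_eq [IsProbabilityMeasure μ] (hN : N.IsModel μ lam R) (α σ β : ℝ)
    (m : Fin M) :
    ENNReal.ofReal (N.coverage μ α σ β m)
      = ∫⁻ ω, expNeg (ENNReal.ofReal (β * N.X α m ω)
          * (N.interference α m ω + ENNReal.ofReal (σ ^ 2))) ∂μ := by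
  let Z (ω : Ω) : ENNReal :=
    ENNReal.ofReal (β * N.X α m ω) * (N.interference α m ω + ENNReal.ofReal (σ ^ 2))
  have hZS := N.measurable_sigmaOf_compl_cellGain α σ β m
  have hZ : Measurable Z := hZS.mono (hN.sigmaOf_le _) le_rfl
  have hg : Measurable fun ω => ‖N.cellGain m ω‖ ^ 2 := (hN.cellGain_measurable m).norm.pow_const 2
  have hgS := N.measurable_sigmaOf_cellGain (S := {.cellGain m}) (m := m) rfl
  have hind := hN.indep_sigmaOf (S := {.cellGain m}ᶜ) (T := {.cellGain m}) disjoint_compl_left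
  have hi : IndepFun Z (fun ω => ‖N.cellGain m ω‖ ^ 2) μ := indepFun_of_measurable hind hZS hgS
  have h1 : μ {ω | ENNReal.ofReal β ≤ N.sinr α σ m ω}
      = μ {ω | Z ω ≤ ENNReal.ofReal (‖N.cellGain m ω‖ ^ 2)} := by
    refine measure_congr ?_
    filter_upwards [hN.ae_le_sinr_iff α σ β m] with ω hω
    exact propext hω
  rw [coverage, ofReal_measureReal, h1]
  exact measure_le_ofReal_of_exp hZ hg hi (hN.cellGain_law m)

/-- With `X` held fixed, the noise factor splits off and the interference contributes its Laplace
transform at `s = β X`. The factor `X^(2/α)` appears because `theta` depends on the threshold only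
through its power `2/α`. -/
lemma coverage_eq [IsProbabilityMeasure μ] (hN : N.IsModel μ lam R) (hlam : 0 < lam) {α : ℝ}
    (hα : 2 < α) (σ : ℝ) {β : ℝ} (hβ : 0 < β)
    (hp : Integrable (fun ω => N.power 0 ω ^ (2 / α)) μ) (m : Fin M) :
    N.coverage μ α σ β m
      = ∫ ω, Real.exp (-(β * σ ^ 2) * N.X α m ω
          - theta α lam β (N.markProb μ m) (N.powerMoment μ α) * N.X α m ω ^ (2 / α)) ∂μ := by
  have hXm := hN.measurable_X α m
  have hIm := hN.measurable_interference α m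
  let S : Set (Source M) := {.cellPos m, .cellPower m}
  have hi : IndepFun (N.X α m) (N.interference α m) μ :=
    indepFun_of_measurable (hN.indep_sigmaOf (S := S) (T := Sᶜ) disjoint_compl_right)
      (N.measurable_sigmaOf_X α (by simp [S]) (by simp [S]))
      (N.measurable_sigmaOf_interference α m (by simp [S]) (by simp [S]) (by simp [S])
        (by simp [S]))
  have h1 := lintegral_comp_of_indepFun hXm hIm hi
    (G := fun z : ℝ × ENNReal => expNeg (ENNReal.ofReal (β * z.1)
      * (z.2 + ENNReal.ofReal (σ ^ 2)))) (by fun_prop)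
  rw [integral_eq_lintegral_of_nonneg_ae (Filter.Eventually.of_forall fun _ => (Real.exp_pos _).le)
      (by fun_prop),
    ← ENNReal.toReal_ofReal (r := N.coverage μ α σ β m) measureReal_nonneg,
    hN.ofReal_coverage_eq α σ β m, h1]
  congr 1
  refine lintegral_congr_ae ?_
  filter_upwards [hN.ae_X_pos α m] with ω hX
  have hβX : 0 ≤ β * N.X α m ω := by positivity
  simp_rw [mul_add, expNeg_add]
  rw [lintegral_mul_const _ (by fun_prop), hN.lintegral_expNeg_interference hlam hα hp m hβX,
    ← ENNReal.ofReal_mul hβX, expNeg_ofReal (by positivity), ← ENNReal.ofReal_mul (by positivity),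
    ← Real.exp_add]
  congr 2
  rw [theta, theta, Real.mul_rpow hβ.le hX.le]
  ring

/-! ### The law of `X`, the mean count and the law of the distance -/

lemma cdf_X_of_neg [IsProbabilityMeasure μ] (hN : N.IsModel μ lam R) (α : ℝ) (m : Fin M) {x : ℝ}
    (hx : x < 0) : cdf (μ.map (N.X α m)) x = 0 := by
  have hXm := hN.measurable_X α m
  have := Measure.isProbabilityMeasure_map (μ := μ) hXm.aemeasurable
  rw [cdf_eq_real, map_measureReal_apply hXm measurableSet_Iic, measureReal_eq_zero_iff]
  refine measure_mono_null ?_ (ae_iff.1 (hN.ae_X_pos α m))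
  intro ω hω
  exact not_lt.2 ((Set.mem_Iic.1 hω).trans hx.le)

/-- Almost surely `X ≤ x` means `d ≤ (x p)^(1/α)`, and the power `p` is independent of the distance
`d`. -/
lemma cdf_X_of_nonneg [IsProbabilityMeasure μ] (hN : N.IsModel μ lam R) {α : ℝ} (hα : 0 < α)
    (m : Fin M) {x : ℝ} (hx : 0 ≤ x) :
    cdf (μ.map (N.X α m)) x
      = ∫ p, cdf (μ.map (N.dist m)) (x ^ (1 / α) * p ^ (1 / α)) ∂(μ.map (N.cellPower m)) := by
  have hXm := hN.measurable_X α m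
  have hdm := hN.measurable_dist m
  have hpm := hN.cellPower_measurable m
  have := Measure.isProbabilityMeasure_map (μ := μ) hXm.aemeasurable
  have := Measure.isProbabilityMeasure_map (μ := μ) hdm.aemeasurable
  have hi : IndepFun (N.cellPower m) (N.dist m) μ :=
    indepFun_of_measurable (hN.indep_sigmaOf (S := {.cellPower m}) (T := {.cellPos m}) (by simp))
      (N.measurable_sigmaOf_cellPower (by simp)) (N.measurable_sigmaOf_dist (by simp))
  have hB : MeasurableSet {z : ℝ × ℝ | z.2 ≤ x ^ (1 / α) * z.1 ^ (1 / α)} :=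
    measurableSet_le measurable_snd (by fun_prop)
  have h2 := lintegral_comp_of_indepFun hpm hdm hi (measurable_one.indicator hB
    (f := (1 : ℝ × ℝ → ENNReal)))
  have h1 : μ (N.X α m ⁻¹' Set.Iic x)
      = μ {ω | N.dist m ω ≤ x ^ (1 / α) * N.cellPower m ω ^ (1 / α)} := by
    refine measure_congr ?_
    filter_upwards [hN.ae_dist_pos m, hN.cellPower_pos m] with ω hd hp
    refine propext ?_
    change N.dist m ω ^ α / N.cellPower m ω ≤ x ↔ _ ≤ _
    rw [div_le_iff₀ hp, ← Real.mul_rpow hx hp.le, one_div,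
      Real.le_rpow_inv_iff_of_pos hd.le (by positivity) hα]
  have hcm : Measurable fun p : ℝ => cdf (μ.map (N.dist m)) (x ^ (1 / α) * p ^ (1 / α)) :=
    (monotone_cdf _).measurable.comp (by fun_prop)
  rw [integral_eq_lintegral_of_nonneg_ae (Filter.Eventually.of_forall fun _ => cdf_nonneg _ _)
      hcm.aestronglyMeasurable, ← ENNReal.toReal_ofReal (r := cdf _ x) (cdf_nonneg _ _)]
  congr 1
  rw [lintegral_map hcm.ennreal_ofReal hpm, ofReal_cdf, Measure.map_apply hXm measurableSet_Iic, h1,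
    ← lintegral_indicator_one (measurableSet_le hdm (by fun_prop))]
  refine h2.trans (lintegral_congr fun ω => ?_)
  rw [ofReal_cdf, Measure.map_apply hdm measurableSet_Iic,
    ← lintegral_indicator_one (hdm measurableSet_Iic)]
  rfl

/-- Only linearity is needed: each point contributes `q P(x_k ∈ B)` by independence of mark and
position, and the probabilities add up to the intensity of `B`. -/
lemma lintegral_cellCount [IsProbabilityMeasure μ] (hN : N.IsModel μ lam R) (hlam : 0 < lam)
    (hR : 0 < R) (m : Fin M) :
    ∫⁻ ω, (N.cellCount R m ω : ENNReal) ∂μ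
      = ENNReal.ofReal (N.markProb μ m * lam * Real.pi * R ^ 2) := by
  let B : Set Plane := Metric.closedBall 0 R
  have hB : MeasurableSet B := measurableSet_closedBall
  have h1 (ω : Ω) : (N.cellCount R m ω : ENNReal)
      = ∑' k, ({m} : Set (Fin M)).indicator (1 : Fin M → ENNReal) (N.mark k ω)
          * B.indicator 1 (N.pos k ω) := by
    rw [cellCount, ← ENNReal.tsum_set_one,
      tsum_subtype {k : ℕ | N.mark k ω = m ∧ N.pos k ω ∈ B} (fun _ => (1 : ENNReal))]
    refine tsum_congr fun k => ?_
    by_cases h : N.mark k ω = m <;> by_cases h' : N.pos k ω ∈ B <;> simp [h, h']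
  have hM : Measurable (({m} : Set (Fin M)).indicator (1 : Fin M → ENNReal)) := .of_discrete
  have hmk (k : ℕ) : Measurable fun ω =>
      ({m} : Set (Fin M)).indicator (1 : Fin M → ENNReal) (N.mark k ω) :=
    hM.comp (hN.mark_measurable k)
  have hpk (k : ℕ) : Measurable fun ω => B.indicator (1 : Plane → ENNReal) (N.pos k ω) :=
    (measurable_one.indicator hB).comp (hN.poisson.measurable k)
  have hi (k : ℕ) : IndepFun
      (fun ω => ({m} : Set (Fin M)).indicator (1 : Fin M → ENNReal) (N.mark k ω))
      (fun ω => B.indicator (1 : Plane → ENNReal) (N.pos k ω)) μ :=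
    (indepFun_of_measurable (hN.indep_sigmaOf (S := {.mark k}) (T := {.pos}) (by simp))
      (N.measurable_sigmaOf_mark (k := k) (by simp)) (N.measurable_sigmaOf_pos (by simp) k)).comp
      hM (measurable_one.indicator hB)
  have hq (k : ℕ) : ∫⁻ ω, ({m} : Set (Fin M)).indicator (1 : Fin M → ENNReal) (N.mark k ω) ∂μ
      = ENNReal.ofReal (N.markProb μ m) := by
    rw [markProb, ofReal_measureReal, ← lintegral_indicator_one (hN.measurableSet_mark_eq 0 m)]
    exact ((hN.mark_ident k).comp (u := ({m} : Set (Fin M)).indicator (1 : Fin M → ENNReal))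
      hM).lintegral_eq
  have hν : (ENNReal.ofReal lam • volume : Measure Plane) B
      = ENNReal.ofReal (lam * Real.pi * R ^ 2) := by
    rw [Measure.smul_apply, EuclideanSpace.volume_closedBall_fin_two, smul_eq_mul,
      ← ENNReal.ofReal_pow hR.le, ← ENNReal.ofReal_mul (by positivity),
      ← ENNReal.ofReal_mul hlam.le]
    ring_nf
  have hc := hN.poisson.lintegral_coe_count hB (by rw [hν]; exact ENNReal.ofReal_lt_top)
  simp_rw [coe_count] at hc
  rw [lintegral_tsum fun k => (hpk k).aemeasurable] at hc
  simp_rw [h1]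
  have hmpk (k : ℕ) : Measurable fun ω =>
      ({m} : Set (Fin M)).indicator (1 : Fin M → ENNReal) (N.mark k ω)
        * B.indicator 1 (N.pos k ω) := (hmk k).mul (hpk k)
  rw [lintegral_tsum fun k => (hmpk k).aemeasurable]
  simp_rw [fun k => lintegral_mul_eq_lintegral_mul_lintegral_of_indepFun''
    (hmk k).aemeasurable (hpk k).aemeasurable (hi k), hq]
  rw [ENNReal.tsum_mul_left, hc, hν, ← ENNReal.ofReal_mul (by exact measureReal_nonneg)]
  ring_nf

/-- The distance of a cellular user to the eNB has density `2 r / R ^ 2` on `[0, R]`. -/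
lemma integral_comp_dist (hN : N.IsModel μ lam R) (hR : 0 < R) (m : Fin M) {f : ℝ → ℝ}
    (hf : Measurable f) :
    ∫ ω, f (N.dist m ω) ∂μ = ∫ r in (0 : ℝ)..R, f r * (2 * r / R ^ 2) := by
  have h1 : ∫ ω, f (N.dist m ω) ∂μ = ∫ y, f ‖y‖ ∂(μ.map (N.cellPos m)) := by
    have hfn : Measurable fun y : Plane => f ‖y‖ := hf.comp measurable_norm
    rw [integral_map (hN.cellPos_measurable m).aemeasurable hfn.aestronglyMeasurable]
    rfl
  have h2 : ∫ y in Metric.closedBall (0 : Plane) R, f ‖y‖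
      = ∫ y : Plane, (Set.Iic R).indicator f ‖y‖ := by
    rw [← integral_indicator measurableSet_closedBall]
    congr 1 with y
    by_cases h : ‖y‖ ≤ R <;> simp [Set.indicator, h]
  have h3 : (volume.real (Metric.ball (0 : Plane) 1)) = Real.pi := by
    simp [Measure.real, EuclideanSpace.volume_ball_fin_two, Real.pi_pos.le]
  have h4 : ∫ r in Set.Ioi (0 : ℝ), r ^ (2 - 1) • (Set.Iic R).indicator f r
      = ∫ r in Set.Ioc 0 R, r * f r := by
    rw [← Set.Ioi_inter_Iic, ← setIntegral_indicator measurableSet_Iic]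
    congr 1 with r
    by_cases h : r ≤ R <;> simp [Set.indicator, h]
  -- Polar coordinates give dimension times unit-disk area, `2 π`, against the normalization `1 / (π
  -- R²)`.
  rw [h1, hN.cellPos_uniform m, ProbabilityTheory.cond, integral_smul_measure, h2,
    integral_fun_norm_addHaar, finrank_euclideanSpace_fin, h4, h3,
    EuclideanSpace.volume_closedBall_fin_two, intervalIntegral.integral_of_le hR.le]
  have h5 : (fun r => f r * (2 * r / R ^ 2)) = fun r => (2 / R ^ 2) * (r * f r) := by
    ext r
    ring
  rw [h5, integral_const_mul]
  have hπ := Real.pi_pos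
  simp only [ENNReal.toReal_inv, ENNReal.toReal_mul, ENNReal.toReal_pow,
    ENNReal.toReal_ofReal hR.le, ENNReal.toReal_ofReal hπ.le, smul_eq_mul, nsmul_eq_mul]
  push_cast
  field_simp

lemma coverage_interference_limited [IsProbabilityMeasure μ] (hN : N.IsModel μ lam R)
    (hlam : 0 < lam) (hR : 0 < R) {α : ℝ} (hα : 2 < α) {β : ℝ} (hβ : 0 < β)
    (hp : Integrable (fun ω => N.power 0 ω ^ (2 / α)) μ) (m : Fin M) {p₀ : ℝ} (hp₀ : 0 < p₀)
    (hconst : ∀ᵐ ω ∂μ, N.cellPower m ω = p₀) :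
    N.coverage μ α 0 β m
      = ∫ r in (0 : ℝ)..R, Real.exp (-(theta α lam β (N.markProb μ m) (N.powerMoment μ α)
          * r ^ 2 * p₀ ^ (-(2 / α)))) * (2 * r / R ^ 2) := by
  rw [hN.coverage_eq hlam hα 0 hβ hp m, ← hN.integral_comp_dist hR m
    (f := fun r => Real.exp (-(theta α lam β (N.markProb μ m) (N.powerMoment μ α)
          * r ^ 2 * p₀ ^ (-(2 / α))))) (by fun_prop)]
  refine integral_congr_ae ?_
  filter_upwards [hconst, hN.ae_dist_pos m] with ω hω hd
  have hα0 : α ≠ 0 := by linarith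
  rw [X, hω, Real.div_rpow (by positivity) hp₀.le, ← Real.rpow_mul hd.le,
    mul_div_cancel₀ _ hα0, Real.rpow_two, Real.rpow_neg hp₀.le]
  ring_nf

end Network.IsModel

lemma integral_exp_neg_mul_sq_mul {a R : ℝ} (ha : 0 < a) (hR : 0 < R) :
    ∫ r in (0 : ℝ)..R, Real.exp (-(a * r ^ 2)) * (2 * r / R ^ 2)
      = (1 - Real.exp (-(a * R ^ 2))) / (a * R ^ 2) := by
  -- An explicit antiderivative, available because `r dr` is half the differential of `r²`.
  have hd (r : ℝ) : HasDerivAt (fun r => -Real.exp (-(a * r ^ 2)) / (a * R ^ 2))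
      (Real.exp (-(a * r ^ 2)) * (2 * r / R ^ 2)) r := by
    have h := (((hasDerivAt_pow 2 r).const_mul a).neg.exp.neg).div_const (a * R ^ 2)
    refine h.congr_deriv ?_
    simp only [Pi.neg_apply]
    field_simp
    ring
  rw [intervalIntegral.integral_eq_sub_of_hasDerivAt (fun r _ => hd r)
    (Continuous.intervalIntegrable (by fun_prop) _ _)]
  simp
  ring

end D2D

end

theorem proposition1 {Ω : Type*} [MeasurableSpace Ω] (μ : Measure Ω) [IsProbabilityMeasure μ]
    {M : ℕ} (N : D2D.Network Ω M) (lam R α σ β : ℝ)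
    (hlam : 0 < lam) (hR : 0 < R) (hα : 2 < α) (hβ : 0 < β)
    (hN : N.IsModel μ lam R)
    (hp : Integrable (fun ω => N.power 0 ω ^ (2 / α)) μ) (m : Fin M) :
    -- the coverage probability
    N.coverage μ α σ β m
      = ∫ ω, Real.exp (-(β * σ ^ 2) * N.X α m ω
          - D2D.theta α lam β (N.markProb μ m) (N.powerMoment μ α) * N.X α m ω ^ (2 / α)) ∂μ ∧
    -- the cdf of `X`
    (∀ x : ℝ, x < 0 → cdf (μ.map (N.X α m)) x = 0) ∧
    (∀ x : ℝ, 0 ≤ x → cdf (μ.map (N.X α m)) x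
      = ∫ p, cdf (μ.map (N.dist m)) (x ^ (1 / α) * p ^ (1 / α)) ∂(μ.map (N.cellPower m))) ∧
    -- the mean number of D2D transmitters in the cell that share resources with user `m`
    ∫⁻ ω, (N.cellCount R m ω : ENNReal) ∂μ
      = ENNReal.ofReal (N.markProb μ m * lam * Real.pi * R ^ 2) ∧
    -- the interference-limited case with fixed power of the cellular user
    (σ = 0 → ∀ p₀ : ℝ, 0 < p₀ → (∀ᵐ ω ∂μ, N.cellPower m ω = p₀) →
      N.coverage μ α σ β m
        = ∫ r in (0 : ℝ)..R, Real.exp (-(D2D.theta α lam β (N.markProb μ m) (N.powerMoment μ α)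
            * r ^ 2 * p₀ ^ (-(2 / α)))) * (2 * r / R ^ 2) ∧
      (0 < N.markProb μ m → 0 < N.powerMoment μ α →
        ∀ c : ℝ, c = (∫⁻ ω, (N.cellCount R m ω : ENNReal) ∂μ).toReal * β ^ (2 / α)
            / (D2D.nsinc (2 / α) * p₀ ^ (2 / α)) * N.powerMoment μ α →
          0 < c ∧ N.coverage μ α σ β m = (1 - Real.exp (-c)) / c)) := by
  have hα0 : 0 < α := by linarith
  refine ⟨hN.coverage_eq hlam hα σ hβ hp m, fun x => hN.cdf_X_of_neg α m,
    fun x => hN.cdf_X_of_nonneg hα0 m, hN.lintegral_cellCount hlam hR m, ?_⟩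
  rintro rfl p₀ hp₀ hconst
  have hcov := hN.coverage_interference_limited hlam hR hα hβ hp m hp₀ hconst
  refine ⟨hcov, ?_⟩
  rintro hq he c rfl
  have hsinc : 0 < D2D.nsinc (2 / α) := D2D.nsinc_pos (by positivity) (by rwa [div_lt_one hα0])
  set a := D2D.theta α lam β (N.markProb μ m) (N.powerMoment μ α) * p₀ ^ (-(2 / α)) with ha
  -- The mean count `q λ π R²` supplies the factor `π q λ` of `θ₀` together with `R²`.
  have hc : (∫⁻ ω, (N.cellCount R m ω : ENNReal) ∂μ).toReal * β ^ (2 / α)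
      / (D2D.nsinc (2 / α) * p₀ ^ (2 / α)) * N.powerMoment μ α = a * R ^ 2 := by
    rw [hN.lintegral_cellCount hlam hR m, ENNReal.toReal_ofReal (by positivity), ha, D2D.theta,
      Real.rpow_neg hp₀.le]
    field_simp
  have ha0 : 0 < a := by
    rw [ha, D2D.theta]
    positivity
  rw [hc]
  refine ⟨by positivity, ?_⟩
  rw [hcov, ← D2D.integral_exp_neg_mul_sq_mul ha0 hR]
  refine intervalIntegral.integral_congr fun r _ => ?_
  simp only [ha]
  ring_nf
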